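/- Let $\mathcal H$ be a real separable Hilbert space with its Borel $\sigma$-algebra, $(\Omega,\mathcal A,\mathbb P)$ a probability space, and $f:\mathcal H\to\mathbb R$ a convex differentiable function whose gradient is $L$-Lipschitz continuous, $L>0$, with $\operatorname{argmin} f\neq\emptyset$. Let $\alpha>3$, put $\alpha_k=1-\frac{\alpha}{k}$ for $k\ge 1$, and let $(s_k)_{k\ge 0}$ be a non-increasing sequence in $]0,1/L]$. Let $(e_k)_{k\ge0}$ be $\mathcal H$-valued random variables, let $y_0$ be a square-integrable $\mathcal H$-valued random variable, put $w_{-1}=y_0$, and let $(y_k)$, $(w_k)$ be generated by the stochastic Ravine accelerated gradient method (SRAG): for all $k\ge 0$, $$w_k=y_k-s_k\big(\nabla f(y_k)+e_k\big),\qquad y_{k+1}=w_k+\alpha_{k+1}(w_k-w_{k-1}).$$ Let $\mathcal F_k=\sigma\big(y_0,(w_i)_{0\le i\le k-1}\big)$ and $\sigma_k=\mathbb E\big[\|e_k\|^2\,\big|\,\mathcal F_k\big]^{1/2}$, a $[0,+\infty]$-valued random variable. Assume that for every $k\ge 1$ the variable $e_k$ is integrable with $\mathbb E[e_k\mid\mathcal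 F_k]=0$ almost surely, and that $\sum_{k\ge1} k\,s_k\,\sigma_k<+\infty$ almost surely. Then: (i) almost surely, $f(y_k)-\min_{\mathcal H} f=o\big(\frac{1}{s_kk^2}\big)$ and $\|y_k-y_{k-1}\|=o\big(\frac1k\big)$ as $k\to+\infty$; (ii) almost surely, $\sum_{k\ge 1} k\,s_k\,(f(y_k)-\min_{\mathcal H} f)<+\infty$ and $\sum_{k\ge 1} k\,\|y_k-y_{k-1}\|^2<+\infty$; (iii) if moreover $\inf_k s_k>0$, then almost surely $\sum_{k\ge1} k^2\|\nabla f(y_k)\|^2<+\infty$, and there is an $\operatorname{argmin}(f)$-valued random variable to which $(y_k)$ converges weakly almost surely. -/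

import Mathlib

open MeasureTheory Filter Topology Asymptotics
open scoped ENNReal NNReal

namespace StochRavine

/-- The set of global minimizers of `f`. -/
def argmin {H : Type*} (f : H → ℝ) : Set H := {x | ∀ z, f x ≤ f z}

/-- The sequences `y` and `w` of random vectors are generated by the stochastic Ravine accelerated
gradient method with step sizes `s k`, extrapolation coefficients `a (k + 1)`, gradient errors `e k`,
and the initialization `w (-1) = y 0`:
for all `k ≥ 0`, `w k = y k - s k (∇ f (y k) + e k)` and
`y (k + 1) = w k + a (k + 1) (w k - w (k - 1))`. -/
structure IsSRAG {Ω H : Type*} [NormedAddCommGroup H] [InnerProductSpace ℝ H] [CompleteSpace H]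
    (f : H → ℝ) (s a : ℕ → ℝ) (e y w : ℕ → Ω → H) : Prop where
  w_eq : ∀ k ω, w k ω = y k ω - s k • (gradient f (y k ω) + e k ω)
  y_one : ∀ ω, y 1 ω = w 0 ω + a 1 • (w 0 ω - y 0 ω)
  y_succ : ∀ k ω, y (k + 2) ω = w (k + 1) ω + a (k + 2) • (w (k + 1) ω - w k ω)

/-- The canonical filtration `ℱ k = σ(y 0, w 0, …, w (k - 1))`. -/
abbrev canonicalSigma {Ω H : Type*} [MeasurableSpace H] (y w : ℕ → Ω → H) (k : ℕ) :
    MeasurableSpace Ω :=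
  MeasurableSpace.comap (y 0) inferInstance ⊔
    ⨆ i ∈ Finset.range k, MeasurableSpace.comap (w i) inferInstance

/-- The conditional standard deviation `σ = 𝔼[‖X‖² | m]^(1/2)`, where the conditional expectation of
the nonnegative variable `‖X‖²` is taken with values in `[0, ∞]`. It is `m`-measurable. -/
noncomputable def condStd {Ω H : Type*} [NormedAddCommGroup H] {mΩ : MeasurableSpace Ω}
    (μ : Measure Ω) (m : MeasurableSpace Ω) (X : Ω → H) (ω : Ω) : ℝ≥0∞ :=
  (condLExp m μ (fun ω' => ‖X ω'‖ₑ ^ 2) ω) ^ (1 / 2 : ℝ)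

/-- Weak convergence of a sequence in a real Hilbert space. -/
def WeaklyConverges {H : Type*} [NormedAddCommGroup H] [InnerProductSpace ℝ H]
    (x : ℕ → H) (l : H) : Prop :=
  Tendsto (fun k => toWeakSpace ℝ H (x k)) atTop (𝓝 (toWeakSpace ℝ H l))

end StochRavine

/-! Put `x 0 = y 0` and `x (k+1) = w k`. The Ravine method then becomes an inexact Nesterov method
for `x`, whose extrapolated points are the `y k`. Two Lyapunov functions carry the argument. The
energy anchored at a minimizer `p`, with `t_k = k / (α - 1)`, is `s t_k² (f x - f p) + ½ ‖x + t_k Δx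
- p‖²`. It decreases up to noise (`anchored_energy_step`). The dissipation controls `k s (f x - f
p)`, because `α > 3`, and the squared gradient terms weighted by `(k s)²`. The mechanical energy `k²
(s (f x - f p) + ½ ‖Δx‖²)` decreases up to noise and a multiple of `k s (f x - f p)`, which the
first energy has made summable. Its dissipation yields `∑ k ‖Δx‖² < ∞`. Its limit must be zero,
since its quotient by `k + 1` is summable; this upgrades `O` to `o`. In both steps the noise enters
through a conditionally centred linear term and through `(k s)² ‖e‖²`. The conditional means of the
latter are summable because `ℓ¹ ⊆ ℓ²`. The energies need not be integrable, so Robbins-Siegmund is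
proved by localization (`robbinsSiegmund`, `setLIntegral_add_le_of_pathwise`). The rates pass from
`x` to `y` through `localResidual`. Weak convergence is Opial's lemma: the anchored energy makes `‖y
k - p‖` converge for all `p` in a countable dense set of minimizers outside a single null set. -/

namespace StochRavine

/-! ### Smooth convex functions: tangent, descent and interpolation inequalities. -/

section Convex

variable {H : Type*} [NormedAddCommGroup H] [InnerProductSpace ℝ H] [CompleteSpace H] {f : H → ℝ}

theorem hasDerivAt_comp_line (hdiff : Differentiable ℝ f) (x v : H) (t : ℝ) :
    HasDerivAt (fun r : ℝ => f (x + r • v)) (inner ℝ (gradient f (x + t • v)) v) t := by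
  have h1 : HasDerivAt (fun r : ℝ => x + r • v) v t := by
    simpa using ((hasDerivAt_id t).smul_const v).const_add x
  have h2 := (hdiff (x + t • v)).hasGradientAt.hasFDerivAt
  exact h2.comp_hasDerivAt t h1

/-- A differentiable convex function lies above its tangent hyperplanes. -/
theorem add_inner_gradient_le (hconv : ConvexOn ℝ Set.univ f) (hdiff : Differentiable ℝ f)
    (x z : H) : f x + inner ℝ (gradient f x) (z - x) ≤ f z := by
  have hd := hasDerivAt_comp_line hdiff x (z - x) 0
  have hc : ConvexOn ℝ Set.univ (fun r : ℝ => f (x + r • (z - x))) := by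
    have := hconv.comp_affineMap (AffineMap.lineMap x z : ℝ →ᵃ[ℝ] H)
    simpa [AffineMap.lineMap_apply, Function.comp_def, add_comm] using this
  have := hc.le_slope_of_hasDerivAt (Set.mem_univ 0) (Set.mem_univ 1) one_pos hd
  simp only [slope_def_field, zero_smul, add_zero, one_smul, add_sub_cancel, sub_zero, div_one] at this
  linarith

/-- The descent lemma for functions with a Lipschitz gradient. -/
theorem le_add_inner_gradient_add_sq (hdiff : Differentiable ℝ f) {L : ℝ≥0}
    (hLip : LipschitzWith L (gradient f)) (x z : H) :
    f z ≤ f x + inner ℝ (gradient f x) (z - x) + L / 2 * ‖z - x‖ ^ 2 := by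
  set v := z - x with hv
  -- Along the segment the candidate upper bound is subtracted. Cauchy-Schwarz and the Lipschitz
  -- bound make the derivative nonpositive, and the claim is `ψ 1 ≤ ψ 0`.
  let ψ : ℝ → ℝ := fun t =>
    f (x + t • v) - t * inner ℝ (gradient f x) v - t ^ 2 * (L / 2 * ‖v‖ ^ 2)
  have hψ : ∀ t, HasDerivAt ψ (inner ℝ (gradient f (x + t • v)) v - inner ℝ (gradient f x) v
      - (2 * t) * (L / 2 * ‖v‖ ^ 2)) t := by
    intro t
    refine ((hasDerivAt_comp_line hdiff x v t).sub ?_).sub ?_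
    · simpa using (hasDerivAt_id t).mul_const (inner ℝ (gradient f x) v)
    · simpa using (hasDerivAt_pow 2 t).mul_const (L / 2 * ‖v‖ ^ 2)
  have hanti : AntitoneOn ψ (Set.Icc 0 1) := by
    refine antitoneOn_of_deriv_nonpos (convex_Icc 0 1)
      (fun t _ => (hψ t).continuousAt.continuousWithinAt)
      (fun t _ => (hψ t).differentiableAt.differentiableWithinAt) fun t ht => ?_
    rw [interior_Icc] at ht
    rw [(hψ t).deriv, ← inner_sub_left]
    have h1 := real_inner_le_norm (gradient f (x + t • v) - gradient f x) v
    have h2 := hLip.norm_sub_le (x + t • v) x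
    rw [add_sub_cancel_left, norm_smul, Real.norm_of_nonneg ht.1.le] at h2
    have := mul_le_mul_of_nonneg_right h2 (norm_nonneg v)
    nlinarith
  have := hanti (Set.left_mem_Icc.2 zero_le_one) (Set.right_mem_Icc.2 zero_le_one) zero_le_one
  simp only [ψ, hv, zero_smul, add_zero, one_smul, add_sub_cancel, one_mul, zero_mul, one_pow,
    sub_zero, ne_eq, OfNat.ofNat_ne_zero, not_false_eq_true, zero_pow] at this
  linarith

/-- The interpolation inequality for convex functions with a Lipschitz gradient. -/
theorem add_inner_gradient_add_sq_le (hconv : ConvexOn ℝ Set.univ f) (hdiff : Differentiable ℝ f)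
    {L : ℝ≥0} (hL : 0 < L) (hLip : LipschitzWith L (gradient f)) (x z : H) :
    f x + inner ℝ (gradient f x) (z - x) + 1 / (2 * L) * ‖gradient f z - gradient f x‖ ^ 2
      ≤ f z := by
  have hL' : (0 : ℝ) < L := hL
  set d := gradient f z - gradient f x with hd
  -- The test point `z - d / L` minimizes the quadratic upper bound at `z` of `f` minus its linear
  -- part at `x`. There the tangent at `x` and the descent lemma at `z` are compared.
  have h1 := add_inner_gradient_le hconv hdiff x (z - (1 / (L : ℝ)) • d)
  have h2 := le_add_inner_gradient_add_sq hdiff hLip z (z - (1 / (L : ℝ)) • d)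
  have h3 : inner ℝ (gradient f z) d - inner ℝ (gradient f x) d = ‖d‖ ^ 2 := by
    rw [← inner_sub_left, ← hd, real_inner_self_eq_norm_sq]
  have e1 : z - (1 / (L : ℝ)) • d - z = -((1 / (L : ℝ)) • d) := by abel
  have e2 : z - (1 / (L : ℝ)) • d - x = (z - x) - (1 / (L : ℝ)) • d := by abel
  rw [e2, inner_sub_right, real_inner_smul_right] at h1
  rw [e1, inner_neg_right, real_inner_smul_right, norm_neg, norm_smul, mul_pow, Real.norm_eq_abs,
    sq_abs] at h2
  have h4 : (L : ℝ) / 2 * ((1 / L) ^ 2 * ‖d‖ ^ 2) = 1 / (2 * L) * ‖d‖ ^ 2 := by field_simp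
  have h5 : 1 / (L : ℝ) * ‖d‖ ^ 2 = 2 * (1 / (2 * L) * ‖d‖ ^ 2) := by field_simp
  have h6 : 1 / (L : ℝ) * inner ℝ (gradient f z) d - 1 / (L : ℝ) * inner ℝ (gradient f x) d
    = 1 / (L : ℝ) * ‖d‖ ^ 2 := by rw [← h3]; ring
  linarith

theorem gradient_eq_zero_of_mem_argmin {x : H} (hx : x ∈ argmin f) : gradient f x = 0 := by
  have : IsLocalMin f x := Eventually.of_forall hx
  simp [gradient, this.fderiv_eq_zero]

theorem norm_gradient_sq_le (hconv : ConvexOn ℝ Set.univ f) (hdiff : Differentiable ℝ f)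
    {L : ℝ≥0} (hL : 0 < L) (hLip : LipschitzWith L (gradient f)) {p : H} (hp : p ∈ argmin f)
    (x : H) : ‖gradient f x‖ ^ 2 ≤ 2 * L * (f x - f p) := by
  have hL' : (0 : ℝ) < L := hL
  have h := add_inner_gradient_add_sq_le hconv hdiff hL hLip p x
  rw [gradient_eq_zero_of_mem_argmin hp] at h
  simp only [inner_zero_left, sub_zero, add_zero] at h
  have : 1 / (2 * L) * ‖gradient f x‖ ^ 2 ≤ f x - f p := by linarith
  calc ‖gradient f x‖ ^ 2 = 2 * L * (1 / (2 * L) * ‖gradient f x‖ ^ 2) := by field_simp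
    _ ≤ _ := by gcongr

end Convex

/-! ### Almost supermartingales without integrability. -/

section RobbinsSiegmund

variable {Ω : Type*} {mΩ : MeasurableSpace Ω} {μ : Measure Ω}

/-- The last index at which `ω` lies in `B` bounds the whole sum, since later terms vanish. -/
theorem sum_indicator_le {B : ℕ → Set Ω} {U : ℕ → Ω → ℝ≥0∞}
    {m : ℝ≥0∞} (hU : ∀ n, ∀ ω ∈ B n, ∑ k ∈ Finset.range (n + 1), U k ω ≤ m) (n : ℕ) (ω : Ω) :
    ∑ k ∈ Finset.range n, (B k).indicator (U k) ω ≤ m := by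
  induction n with
  | zero => simp
  | succ n ih =>
    by_cases hω : ω ∈ B n
    · refine le_trans (Finset.sum_le_sum fun k _ => ?_) (hU n ω hω)
      exact Set.indicator_le_self _ _ ω
    · rw [Finset.sum_range_succ, Set.indicator_of_notMem hω, add_zero]
      exact ih

/-- The Robbins-Siegmund theorem on the event where `V 0` and the sum of the `U n` are bounded
by `m`. The almost supermartingale inequality is stated through integrals over the events of the
filtration, so that no integrability is required. -/
theorem robbinsSiegmund_of_bound [IsFiniteMeasure μ] {ℱ : Filtration ℕ mΩ}
    {V : ℕ → Ω → ℝ} {D U : ℕ → Ω → ℝ≥0∞} (hV0 : ∀ n ω, 0 ≤ V n ω)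
    (hV : ∀ n, Measurable[ℱ n] (V n)) (hD : ∀ n, Measurable (D n))
    (hU : ∀ n, Measurable[ℱ n] (U n))
    (h : ∀ n, ∀ A, MeasurableSet[ℱ n] A →
      ∫⁻ ω in A, (ENNReal.ofReal (V (n + 1) ω) + D n ω) ∂μ
        ≤ ∫⁻ ω in A, (ENNReal.ofReal (V n ω) + U n ω) ∂μ) (m : ℝ≥0) :
    ∀ᵐ ω ∂μ, ENNReal.ofReal (V 0 ω) ≤ m → ∑' n, U n ω ≤ m →
      (∃ c, Tendsto (fun n => V n ω) atTop (𝓝 c)) ∧ ∑' n, D n ω < ∞ := by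
  have hV' : ∀ n, Measurable (V n) := fun n => (hV n).mono (ℱ.le n) le_rfl
  have hU' : ∀ n, Measurable (U n) := fun n => (hU n).mono (ℱ.le n) le_rfl
  -- Since `U n` is `ℱ n`-measurable, the budget can be tested including its `n`-th term, so these
  -- localizing events are adapted.
  set B : ℕ → Set Ω := fun n =>
    {ω | ENNReal.ofReal (V 0 ω) ≤ m ∧ ∑ k ∈ Finset.range (n + 1), U k ω ≤ m} with hBdef
  have hBanti : Antitone B := by
    intro i j hij ω hω
    refine ⟨hω.1, le_trans ?_ hω.2⟩
    exact Finset.sum_le_sum_of_subset (Finset.range_mono (by omega))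
  have hBm : ∀ n, MeasurableSet[ℱ n] (B n) := by
    intro n
    have h1 : Measurable[ℱ n] fun ω => ENNReal.ofReal (V 0 ω) :=
      ENNReal.measurable_ofReal.comp ((hV 0).mono (ℱ.mono (Nat.zero_le n)) le_rfl)
    have h2 : Measurable[ℱ n] fun ω => ∑ k ∈ Finset.range (n + 1), U k ω := by
      refine Finset.measurable_fun_sum _ fun k hk => (hU k).mono (ℱ.mono ?_) le_rfl
      have := Finset.mem_range.1 hk
      omega
    exact (h1 measurableSet_Iic).inter (h2 measurableSet_Iic)
  have hBm' : ∀ n, MeasurableSet (B n) := fun n => ℱ.le n _ (hBm n)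
  have hsumU : ∀ n ω, ∑ k ∈ Finset.range n, (B k).indicator (U k) ω ≤ m :=
    sum_indicator_le fun n ω hω => hω.2
  have hsumUint : ∀ n, ∑ k ∈ Finset.range n, ∫⁻ ω in B k, U k ω ∂μ ≤ m * μ Set.univ := by
    intro n
    calc ∑ k ∈ Finset.range n, ∫⁻ ω in B k, U k ω ∂μ
        = ∫⁻ ω, ∑ k ∈ Finset.range n, (B k).indicator (U k) ω ∂μ := by
          rw [lintegral_finsetSum _ fun k _ => (hU' k).indicator (hBm' k)]
          exact Finset.sum_congr rfl fun k _ => (lintegral_indicator (hBm' k) _).symm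
      _ ≤ ∫⁻ _, m ∂μ := lintegral_mono (hsumU n)
      _ = m * μ Set.univ := lintegral_const _
  -- The hypothesis is used on `A ∩ B n`. Shrinking to `B (n + 1)` on the left only discards
  -- nonnegative mass.
  have hstep : ∀ n, ∀ A, MeasurableSet[ℱ n] A →
      ∫⁻ ω in A ∩ B (n + 1), ENNReal.ofReal (V (n + 1) ω) ∂μ + ∫⁻ ω in A ∩ B n, D n ω ∂μ
        ≤ ∫⁻ ω in A ∩ B n, ENNReal.ofReal (V n ω) ∂μ + ∫⁻ ω in A ∩ B n, U n ω ∂μ := by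
    intro n A hA
    rw [← lintegral_add_left (hV' n).ennreal_ofReal]
    refine le_trans ?_ (h n _ (hA.inter (hBm n)))
    rw [lintegral_add_left (hV' (n + 1)).ennreal_ofReal]
    gcongr
    exact hBanti (Nat.le_succ n)
  have htele : ∀ n, ∫⁻ ω in B n, ENNReal.ofReal (V n ω) ∂μ
      + ∑ k ∈ Finset.range n, ∫⁻ ω in B k, D k ω ∂μ
        ≤ ∫⁻ ω in B 0, ENNReal.ofReal (V 0 ω) ∂μ
          + ∑ k ∈ Finset.range n, ∫⁻ ω in B k, U k ω ∂μ := by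
    intro n
    induction n with
    | zero => simp
    | succ n ih =>
      have := hstep n Set.univ MeasurableSet.univ
      simp only [Set.univ_inter] at this
      rw [Finset.sum_range_succ, Finset.sum_range_succ, ← add_assoc, ← add_assoc]
      calc _ = ∫⁻ ω in B (n + 1), ENNReal.ofReal (V (n + 1) ω) ∂μ + ∫⁻ ω in B n, D n ω ∂μ
            + ∑ k ∈ Finset.range n, ∫⁻ ω in B k, D k ω ∂μ := by ring
        _ ≤ ∫⁻ ω in B n, ENNReal.ofReal (V n ω) ∂μ + ∫⁻ ω in B n, U n ω ∂μ
            + ∑ k ∈ Finset.range n, ∫⁻ ω in B k, D k ω ∂μ := by gcongr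
        _ = ∫⁻ ω in B n, ENNReal.ofReal (V n ω) ∂μ
            + ∑ k ∈ Finset.range n, ∫⁻ ω in B k, D k ω ∂μ + ∫⁻ ω in B n, U n ω ∂μ := by ring
        _ ≤ _ := by gcongr
  have hP0 : ∫⁻ ω in B 0, ENNReal.ofReal (V 0 ω) ∂μ ≤ m * μ Set.univ := by
    calc ∫⁻ ω in B 0, ENNReal.ofReal (V 0 ω) ∂μ ≤ ∫⁻ _ in B 0, m ∂μ :=
          setLIntegral_mono measurable_const fun ω hω => hω.1
      _ = m * μ (B 0) := by simp
      _ ≤ m * μ Set.univ := by gcongr; exact Set.subset_univ _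
  set K : ℝ≥0∞ := m * μ Set.univ + m * μ Set.univ with hK
  have hKtop : K ≠ ∞ := by
    have : (m : ℝ≥0∞) * μ Set.univ ≠ ∞ := ENNReal.mul_ne_top ENNReal.coe_ne_top (measure_ne_top _ _)
    simp [hK, this]
  have hbound : ∀ n, ∫⁻ ω in B n, ENNReal.ofReal (V n ω) ∂μ
      + ∑ k ∈ Finset.range n, ∫⁻ ω in B k, D k ω ∂μ ≤ K :=
    fun n => (htele n).trans (add_le_add hP0 (hsumUint n))
  have hPK : ∀ n, ∫⁻ ω in B n, ENNReal.ofReal (V n ω) ∂μ ≤ K :=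
    fun n => le_self_add.trans (hbound n)
  -- summability of `D`
  have hDfin : ∀ᵐ ω ∂μ, ∑' n, (B n).indicator (D n) ω < ∞ := by
    refine ae_lt_top (Measurable.tsum fun n => (hD n).indicator (hBm' n)) ?_
    rw [lintegral_tsum fun n => ((hD n).indicator (hBm' n)).aemeasurable]
    refine ne_top_of_le_ne_top hKtop (ENNReal.tsum_le_of_sum_range_le fun n => ?_)
    simp_rw [lintegral_indicator (hBm' _)]
    exact le_add_self.trans (hbound n)
  -- convergence of `V`
  set S : ℕ → Ω → ℝ≥0∞ := fun n ω => ∑ k ∈ Finset.range n, (B k).indicator (U k) ω with hS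
  have hSm : ∀ n, Measurable[ℱ n] (S n) := by
    intro n
    refine Finset.measurable_fun_sum _ fun k hk => ?_
    exact ((hU k).indicator (hBm k)).mono (ℱ.mono (Finset.mem_range.1 hk).le) le_rfl
  -- Subtracting the accumulated, bounded perturbation turns the localized process into a true
  -- supermartingale.
  set X : ℕ → Ω → ℝ := fun n ω => (B n).indicator (V n) ω - (S n ω).toReal with hX
  have hVint : ∀ n, Integrable ((B n).indicator (V n)) μ := by
    intro n
    rw [integrable_indicator_iff (hBm' n)]
    refine ⟨(hV' n).aestronglyMeasurable, ?_⟩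
    rw [hasFiniteIntegral_iff_ofReal (ae_of_all _ (hV0 n))]
    exact (hPK n).trans_lt hKtop.lt_top
  have hSle : ∀ n ω, (S n ω).toReal ≤ m := fun n ω =>
    ENNReal.toReal_le_of_le_ofReal m.2 (by simpa using hsumU n ω)
  have hSint : ∀ n, Integrable (fun ω => (S n ω).toReal) μ := by
    intro n
    refine Integrable.of_bound ((hSm n).mono (ℱ.le n) le_rfl).ennreal_toReal.aestronglyMeasurable
      m (ae_of_all _ fun ω => ?_)
    rw [Real.norm_of_nonneg ENNReal.toReal_nonneg]
    exact hSle n ω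
  have hXint : ∀ n, Integrable (X n) μ := fun n => (hVint n).sub (hSint n)
  have hUlt : ∀ n ω, (B n).indicator (U n) ω < ∞ := by
    intro n ω
    refine lt_of_le_of_lt ?_ (ENNReal.coe_lt_top (r := m))
    refine le_trans ?_ (hsumU (n + 1) ω)
    rw [Finset.sum_range_succ]
    exact le_add_self
  have hSlt : ∀ n ω, S n ω ≠ ∞ := fun n ω => ne_top_of_le_ne_top ENNReal.coe_ne_top (hsumU n ω)
  have hSsucc : ∀ n ω, (S (n + 1) ω).toReal
      = (S n ω).toReal + ((B n).indicator (U n) ω).toReal := by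
    intro n ω
    rw [← ENNReal.toReal_add (hSlt n ω) (hUlt n ω).ne, hS]
    simp only [Finset.sum_range_succ]
  have hUint : ∀ n, Integrable (fun ω => ((B n).indicator (U n) ω).toReal) μ := by
    intro n
    refine ((hSint (n + 1)).sub (hSint n)).congr (ae_of_all _ fun ω => ?_)
    simp [hSsucc]
  have hVset : ∀ n A, MeasurableSet A → ∫ ω in A, (B n).indicator (V n) ω ∂μ
      = (∫⁻ ω in A ∩ B n, ENNReal.ofReal (V n ω) ∂μ).toReal := by
    intro n A hA
    rw [setIntegral_indicator (hBm' n), integral_eq_lintegral_of_nonneg_ae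
      (ae_of_all _ (hV0 n)) (hV' n).aestronglyMeasurable]
  have hUset : ∀ n A, MeasurableSet A → ∫ ω in A, ((B n).indicator (U n) ω).toReal ∂μ
      = (∫⁻ ω in A ∩ B n, U n ω ∂μ).toReal := by
    intro n A hA
    rw [integral_toReal ((hU' n).indicator (hBm' n)).aemeasurable (ae_of_all _ (hUlt n)),
      setLIntegral_indicator (hBm' n), Set.inter_comm]
  have hsuper : Supermartingale X ℱ μ := by
    refine supermartingale_of_setIntegral_succ_le (fun n => ?_) hXint fun n A hA => ?_
    · exact (((hV n).indicator (hBm n)).sub (hSm n).ennreal_toReal).stronglyMeasurable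
    · have hA' := ℱ.le n _ hA
      have e1 : ∀ n, ∫ ω in A, X n ω ∂μ
          = ∫ ω in A, (B n).indicator (V n) ω ∂μ - ∫ ω in A, (S n ω).toReal ∂μ :=
        fun n => integral_sub (hVint n).integrableOn (hSint n).integrableOn
      rw [e1, e1]
      simp_rw [hSsucc]
      rw [integral_add (hSint n).integrableOn (hUint n).integrableOn, hVset _ _ hA', hVset _ _ hA',
        hUset _ _ hA']
      have hfin1 : ∫⁻ ω in A ∩ B n, ENNReal.ofReal (V n ω) ∂μ ≠ ∞ :=
        ne_top_of_le_ne_top hKtop ((lintegral_mono_set Set.inter_subset_right).trans (hPK n))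
      have hfin2 : ∫⁻ ω in A ∩ B n, U n ω ∂μ ≠ ∞ := by
        refine ne_top_of_le_ne_top (b := m * μ Set.univ)
          (ENNReal.mul_ne_top ENNReal.coe_ne_top (measure_ne_top _ _)) ?_
        refine (lintegral_mono_set Set.inter_subset_right).trans ?_
        refine le_trans ?_ (hsumUint (n + 1))
        rw [Finset.sum_range_succ]
        exact le_add_self
      have := ENNReal.toReal_mono (ENNReal.add_ne_top.2 ⟨hfin1, hfin2⟩)
        (le_self_add.trans (hstep n A hA))
      rw [ENNReal.toReal_add hfin1 hfin2] at this
      linarith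
  -- This uniform `L¹` bound lets Doob's convergence theorem apply to the submartingale `-X`.
  have hL1 : ∀ n, eLpNorm ((-X) n) 1 μ ≤ (K + m * μ Set.univ).toNNReal := by
    intro n
    have hfin : K + m * μ Set.univ ≠ ∞ := ENNReal.add_ne_top.2
      ⟨hKtop, ENNReal.mul_ne_top ENNReal.coe_ne_top (measure_ne_top _ _)⟩
    rw [ENNReal.coe_toNNReal hfin, Pi.neg_apply, eLpNorm_neg, eLpNorm_one_eq_lintegral_enorm]
    calc ∫⁻ ω, ‖X n ω‖ₑ ∂μ
        ≤ ∫⁻ ω, ((B n).indicator (fun ω => ENNReal.ofReal (V n ω)) ω + m) ∂μ := by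
          refine lintegral_mono fun ω => (enorm_sub_le).trans (add_le_add ?_ ?_)
          · by_cases hω : ω ∈ B n
            · simp [hω, Real.enorm_eq_ofReal (hV0 n ω)]
            · simp [hω]
          · rw [Real.enorm_eq_ofReal ENNReal.toReal_nonneg, ENNReal.ofReal_toReal (hSlt n ω)]
            exact hsumU n ω
      _ = ∫⁻ ω in B n, ENNReal.ofReal (V n ω) ∂μ + m * μ Set.univ := by
          rw [lintegral_add_right _ measurable_const, lintegral_indicator (hBm' n), lintegral_const]
      _ ≤ _ := by gcongr; exact hPK n
  filter_upwards [hsuper.neg.exists_ae_tendsto_of_bdd hL1, hDfin] with ω hXω hDω h0 hsum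
  have hmem : ∀ n, ω ∈ B n := fun n => ⟨h0, (ENNReal.sum_le_tsum _).trans hsum⟩
  constructor
  · obtain ⟨c, hc⟩ := hXω
    have hSlim : Tendsto (fun n => (S n ω).toReal) atTop (𝓝 (∑' n, U n ω).toReal) := by
      have h1 : Tendsto (fun n => ∑ k ∈ Finset.range n, U k ω) atTop (𝓝 (∑' n, U n ω)) :=
        ENNReal.summable.hasSum.tendsto_sum_nat
      have h2 := (ENNReal.tendsto_toReal (ne_top_of_le_ne_top ENNReal.coe_ne_top hsum)).comp h1
      refine h2.congr fun n => ?_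
      simp only [Function.comp, hS]
      congr 1
      exact Finset.sum_congr rfl fun k _ => by simp [hmem k]
    refine ⟨-c + (∑' n, U n ω).toReal, (hc.neg.add hSlim).congr fun n => ?_⟩
    simp [hX, hmem n]
  · refine lt_of_le_of_lt (le_of_eq ?_) hDω
    exact tsum_congr fun n => by simp [hmem n]

/-- The Robbins-Siegmund theorem, without integrability assumptions. -/
theorem robbinsSiegmund [IsFiniteMeasure μ] {ℱ : Filtration ℕ mΩ}
    {V : ℕ → Ω → ℝ} {D U : ℕ → Ω → ℝ≥0∞} (hV0 : ∀ n ω, 0 ≤ V n ω)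
    (hV : ∀ n, Measurable[ℱ n] (V n)) (hD : ∀ n, Measurable (D n))
    (hU : ∀ n, Measurable[ℱ n] (U n)) (hsum : ∀ᵐ ω ∂μ, ∑' n, U n ω < ∞)
    (h : ∀ n, ∀ A, MeasurableSet[ℱ n] A →
      ∫⁻ ω in A, (ENNReal.ofReal (V (n + 1) ω) + D n ω) ∂μ
        ≤ ∫⁻ ω in A, (ENNReal.ofReal (V n ω) + U n ω) ∂μ) :
    ∀ᵐ ω ∂μ, (∃ c, Tendsto (fun n => V n ω) atTop (𝓝 c)) ∧ ∑' n, D n ω < ∞ := by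
  -- The events for integer budgets `m` cover almost all of `Ω`, as `V 0` is real-valued and the sum
  -- of the `U n` is almost surely finite.
  have := ae_all_iff.2 fun m : ℕ => robbinsSiegmund_of_bound hV0 hV hD hU h (m : ℝ≥0)
  filter_upwards [this, hsum] with ω hω hs
  obtain ⟨m, hm⟩ := ENNReal.exists_nat_gt
    (max_lt (ENNReal.ofReal_lt_top (r := V 0 ω)) hs).ne
  exact hω m (by simpa using (le_max_left _ _).trans hm.le)
    (by simpa using (le_max_right _ _).trans hm.le)

variable {H : Type*} [NormedAddCommGroup H] [InnerProductSpace ℝ H] [CompleteSpace H]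

/-- Cutting `M` off outside `A` makes it bounded, so it can be pulled out of the conditional
expectation of a merely integrable `X`. -/
theorem setIntegral_inner_eq_zero_of_condExp_eq_zero [IsFiniteMeasure μ] {m : MeasurableSpace Ω}
    (hm : m ≤ mΩ) {M X : Ω → H} (hM : StronglyMeasurable[m] M) (hX : Integrable X μ)
    (hX0 : μ[X | m] =ᵐ[μ] 0) {A : Set Ω} (hA : MeasurableSet[m] A) {R : ℝ}
    (hR : ∀ ω ∈ A, ‖M ω‖ ≤ R) :
    IntegrableOn (fun ω => inner ℝ (M ω) (X ω)) A μ ∧ ∫ ω in A, inner ℝ (M ω) (X ω) ∂μ = 0 := by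
  have hN : StronglyMeasurable[m] (A.indicator M) := hM.indicator hA
  have hint : Integrable (fun ω => inner ℝ (A.indicator M ω) (X ω)) μ := by
    refine (hX.norm.const_mul |R|).mono'
      ((hN.mono hm).aestronglyMeasurable.inner hX.aestronglyMeasurable) (ae_of_all _ fun ω => ?_)
    refine (norm_inner_le_norm _ _).trans (mul_le_mul_of_nonneg_right ?_ (norm_nonneg _))
    by_cases hω : ω ∈ A
    · simpa [hω] using (hR ω hω).trans (le_abs_self R)
    · simp [hω]
  have heq : (fun ω => inner ℝ (A.indicator M ω) (X ω))
      = A.indicator fun ω => inner ℝ (M ω) (X ω) := by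
    ext ω
    by_cases hω : ω ∈ A <;> simp [hω]
  refine ⟨by rwa [← integrable_indicator_iff (hm _ hA), ← heq], ?_⟩
  have hpull := condExp_bilin_of_stronglyMeasurable_left (μ := μ) (innerSL ℝ) hN
    hint hX
  rw [← integral_indicator (hm _ hA), ← heq, ← integral_condExp hm]
  refine integral_eq_zero_of_ae ?_
  filter_upwards [hpull, hX0] with ω h1 h2
  exact h1.trans (by rw [h2]; simp)

/-- A pathwise inequality with a conditionally centred linear term in the noise implies the
almost supermartingale inequality. -/
theorem setLIntegral_add_le_of_pathwise [IsFiniteMeasure μ] [MeasurableSpace H] [BorelSpace H]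
    {m : MeasurableSpace Ω} (hm : m ≤ mΩ) {M X : Ω → H} (hM : StronglyMeasurable[m] M)
    (hXm : Measurable[mΩ] X) (hX : Integrable X μ) (hX0 : μ[X | m] =ᵐ[μ] 0) {V u V' D : Ω → ℝ}
    (hV : Measurable[m] V) (hV0 : ∀ ω, 0 ≤ V ω) (hu : Measurable[m] u) (hu0 : ∀ ω, 0 ≤ u ω)
    (hV'0 : ∀ ω, 0 ≤ V' ω) (hD0 : ∀ ω, 0 ≤ D ω) {C : ℝ} (hC : 0 ≤ C)
    (hσ : ∀ᵐ ω ∂μ, condLExp m μ (fun ω' => ‖X ω'‖ₑ ^ 2) ω < ∞)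
    (hpath : ∀ ω, V' ω + D ω ≤ V ω + u ω + inner ℝ (M ω) (X ω) + C * ‖X ω‖ ^ 2)
    {A : Set Ω} (hA : MeasurableSet[m] A) :
    ∫⁻ ω in A, (ENNReal.ofReal (V' ω) + ENNReal.ofReal (D ω)) ∂μ
      ≤ ∫⁻ ω in A, (ENNReal.ofReal (V ω) + (ENNReal.ofReal (u ω) + ENNReal.ofReal C *
        condLExp m μ (fun ω' => ‖X ω'‖ₑ ^ 2) ω)) ∂μ := by
  set σ := condLExp m μ (fun ω' => ‖X ω'‖ₑ ^ 2) with hσdef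
  have hσm : Measurable[m] σ := measurable_condLExp _ _ _
  have hX2 : Measurable[mΩ] fun ω => ‖X ω‖ₑ ^ 2 := (measurable_enorm.comp hXm).pow_const 2
  -- On these `m`-measurable pieces every term is integrable. They exhaust `A` almost everywhere, so
  -- the inequality on `A` follows by monotone convergence.
  let A' : ℕ → Set Ω := fun R =>
    A ∩ {ω | ‖M ω‖ ≤ R} ∩ {ω | V ω ≤ R} ∩ {ω | u ω ≤ R} ∩ {ω | σ ω ≤ R}
  have hA'm : ∀ R, MeasurableSet[m] (A' R) := fun R =>
    (((hA.inter (hM.norm.measurable measurableSet_Iic)).inter (hV measurableSet_Iic)).inter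
      (hu measurableSet_Iic)).inter (hσm measurableSet_Iic)
  have hA'mono : Monotone A' := by
    intro R R' hRR ω hω
    have hc : (R : ℝ) ≤ R' := by exact_mod_cast hRR
    have hc' : (R : ℝ≥0∞) ≤ R' := by exact_mod_cast hRR
    exact ⟨⟨⟨⟨hω.1.1.1.1, hω.1.1.1.2.trans hc⟩, hω.1.1.2.trans hc⟩, hω.1.2.trans hc⟩,
      hω.2.trans hc'⟩
  have hunion : (⋃ R, A' R : Set Ω) =ᵐ[μ] A := by
    filter_upwards [hσ] with ω hω
    refine propext ⟨fun h => ?_, fun h => ?_⟩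
    · obtain ⟨R, hR⟩ := Set.mem_iUnion.1 h
      exact hR.1.1.1.1
    · obtain ⟨R₁, hR₁⟩ := exists_nat_ge (max (max ‖M ω‖ (V ω)) (u ω))
      obtain ⟨R₂, hR₂⟩ := ENNReal.exists_nat_gt hω.ne
      have hc : (R₁ : ℝ) ≤ (max R₁ R₂ : ℕ) := by exact_mod_cast le_max_left _ _
      have hc' : (R₂ : ℝ≥0∞) ≤ (max R₁ R₂ : ℕ) := by exact_mod_cast le_max_right _ _
      refine Set.mem_iUnion.2 ⟨max R₁ R₂, ⟨⟨⟨⟨h, ?_⟩, ?_⟩, ?_⟩, hR₂.le.trans hc'⟩⟩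
      · exact ((le_max_left _ _).trans (le_max_left _ _)).trans (hR₁.trans hc)
      · exact ((le_max_right _ _).trans (le_max_left _ _)).trans (hR₁.trans hc)
      · exact (le_max_right _ _).trans (hR₁.trans hc)
  have hpiece : ∀ R, ∫⁻ ω in A' R, (ENNReal.ofReal (V' ω) + ENNReal.ofReal (D ω)) ∂μ
      ≤ ∫⁻ ω in A' R, (ENNReal.ofReal (V ω) + (ENNReal.ofReal (u ω) + ENNReal.ofReal C * σ ω))
        ∂μ := by
    intro R
    have hAR := hm _ (hA'm R)
    obtain ⟨hint, hzero⟩ := setIntegral_inner_eq_zero_of_condExp_eq_zero hm hM hX hX0 (hA'm R)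
      (R := R) fun ω hω => hω.1.1.1.2
    have hbdd : ∀ g : Ω → ℝ, Measurable[mΩ] g → (∀ ω, 0 ≤ g ω) → (∀ ω ∈ A' R, g ω ≤ R) →
        IntegrableOn g (A' R) μ := by
      intro g hg hg0 hgR
      refine Measure.integrableOn_of_bounded (M := R) (measure_ne_top _ _) hg.aestronglyMeasurable ?_
      refine (ae_restrict_iff' hAR).2 (ae_of_all _ fun ω hω => ?_)
      rw [Real.norm_of_nonneg (hg0 ω)]
      exact hgR ω hω
    have hVi := hbdd V (hV.mono hm le_rfl) hV0 fun ω hω => hω.1.1.2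
    have hui := hbdd u (hu.mono hm le_rfl) hu0 fun ω hω => hω.1.2
    have hnorm : ∀ ω, ENNReal.ofReal (‖X ω‖ ^ 2) = ‖X ω‖ₑ ^ 2 := fun ω => by
      rw [ENNReal.ofReal_pow (norm_nonneg _), ofReal_norm]
    have hXi : IntegrableOn (fun ω => ‖X ω‖ ^ 2) (A' R) μ := by
      refine ⟨((measurable_norm.comp hXm).pow_const 2).aestronglyMeasurable, ?_⟩
      rw [hasFiniteIntegral_iff_ofReal (ae_of_all _ fun ω => by positivity)]
      simp_rw [hnorm]
      -- The second moment over an `m`-measurable set is that of its conditional version, which is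
      -- at most `R` on this piece.
      rw [← setLIntegral_condLExp hm μ _ (hA'm R)]
      calc ∫⁻ ω in A' R, σ ω ∂μ ≤ ∫⁻ _ in A' R, (R : ℝ≥0∞) ∂μ :=
            setLIntegral_mono measurable_const fun ω hω => hω.2
        _ < ∞ := by
          simp only [lintegral_const, Measure.restrict_apply_univ]
          exact ENNReal.mul_lt_top (ENNReal.natCast_lt_top R) (measure_lt_top _ _)
    have hnn : ∀ ω, 0 ≤ V ω + u ω + C * ‖X ω‖ ^ 2 := fun ω =>
      add_nonneg (add_nonneg (hV0 ω) (hu0 ω)) (by positivity)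
    have hi1 : IntegrableOn (fun ω => V ω + u ω + C * ‖X ω‖ ^ 2) (A' R) μ :=
      (hVi.add hui).add (hXi.const_mul C)
    calc ∫⁻ ω in A' R, (ENNReal.ofReal (V' ω) + ENNReal.ofReal (D ω)) ∂μ
        ≤ ∫⁻ ω in A' R,
          ENNReal.ofReal (V ω + u ω + C * ‖X ω‖ ^ 2 + inner ℝ (M ω) (X ω)) ∂μ := by
          refine lintegral_mono fun ω => ?_
          rw [← ENNReal.ofReal_add (hV'0 ω) (hD0 ω)]
          exact ENNReal.ofReal_le_ofReal (by linarith [hpath ω])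
      -- The centred term has no sign, so it is removed at the level of real integrals. The full
      -- integrand is nonnegative because it dominates `V' + D`.
      _ = ENNReal.ofReal
          (∫ ω in A' R, (V ω + u ω + C * ‖X ω‖ ^ 2 + inner ℝ (M ω) (X ω)) ∂μ) := by
          refine (ofReal_integral_eq_lintegral_ofReal (hi1.add hint) (ae_of_all _ fun ω => ?_)).symm
          have := hpath ω
          have h1 := hV'0 ω
          have h2 := hD0 ω
          simp only [Pi.zero_apply, Pi.add_apply]
          linarith
      _ = ENNReal.ofReal (∫ ω in A' R, (V ω + u ω + C * ‖X ω‖ ^ 2) ∂μ) := by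
          rw [integral_add hi1 hint, hzero, add_zero]
      _ = ∫⁻ ω in A' R, ENNReal.ofReal (V ω + u ω + C * ‖X ω‖ ^ 2) ∂μ :=
          ofReal_integral_eq_lintegral_ofReal hi1 (ae_of_all _ hnn)
      _ = ∫⁻ ω in A' R, ((ENNReal.ofReal (V ω) + ENNReal.ofReal (u ω))
            + ENNReal.ofReal C * ‖X ω‖ₑ ^ 2) ∂μ := by
          refine lintegral_congr fun ω => ?_
          rw [ENNReal.ofReal_add (add_nonneg (hV0 ω) (hu0 ω)) (by positivity),
            ENNReal.ofReal_add (hV0 ω) (hu0 ω), ENNReal.ofReal_mul hC, hnorm]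
      _ = ∫⁻ ω in A' R, ((ENNReal.ofReal (V ω) + ENNReal.ofReal (u ω))
            + ENNReal.ofReal C * σ ω) ∂μ := by
          rw [lintegral_add_right _ (hX2.const_mul _),
            lintegral_add_right _ ((hσm.mono hm le_rfl).const_mul _),
            lintegral_const_mul _ hX2, lintegral_const_mul _ (hσm.mono hm le_rfl),
            setLIntegral_condLExp hm μ _ (hA'm R)]
      _ = _ := by simp_rw [add_assoc]
  rw [← setLIntegral_congr hunion, setLIntegral_iUnion_of_directed _ hA'mono.directed_le]
  refine iSup_le fun R => (hpiece R).trans (lintegral_mono_set ?_)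
  intro ω hω
  exact hω.1.1.1.1

end RobbinsSiegmund

/-! ### One-step energy inequalities. -/

section Energy

variable {H : Type*} [NormedAddCommGroup H] [InnerProductSpace ℝ H] [CompleteSpace H] {f : H → ℝ}

/-- The gradient at the new iterate depends on the current noise, so its product with `e` is not
centred. Replacing it by the gradient at the noise-free point `v + s • e` costs only `‖e‖²`, since
`s L ≤ 1`. -/
theorem inner_gradient_sub_le (L : ℝ≥0) (hL : 0 < L) (hLip : LipschitzWith L (gradient f)) {s : ℝ}
    (hs : s ∈ Set.Ioc 0 (1 / (L : ℝ))) (v e : H) :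
    inner ℝ (gradient f (v + s • e) - gradient f v) e ≤ ‖e‖ ^ 2 := by
  have hL' : (0 : ℝ) < L := hL
  have h1 := hLip.norm_sub_le (v + s • e) v
  rw [add_sub_cancel_left, norm_smul, Real.norm_of_nonneg hs.1.le] at h1
  have h2 : (L : ℝ) * s ≤ 1 := by
    have := mul_le_mul_of_nonneg_left hs.2 hL'.le
    rwa [mul_one_div_cancel hL'.ne'] at this
  calc inner ℝ (gradient f (v + s • e) - gradient f v) e
      ≤ ‖gradient f (v + s • e) - gradient f v‖ * ‖e‖ := real_inner_le_norm _ _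
    _ ≤ (L * s * ‖e‖) * ‖e‖ := by rw [mul_assoc (L : ℝ)]; gcongr
    _ ≤ (1 * ‖e‖) * ‖e‖ := by gcongr
    _ = ‖e‖ ^ 2 := by ring

/-- One step of the inertial method decreases the energy anchored at a minimizer `p`, up to a
centred term and a term that is quadratic in the error. -/
theorem anchored_energy_step (hconv : ConvexOn ℝ Set.univ f) (hdiff : Differentiable ℝ f)
    {L : ℝ≥0} (hL : 0 < L) (hLip : LipschitzWith L (gradient f)) {p : H}
    {s : ℝ} (hs : s ∈ Set.Ioc 0 (1 / (L : ℝ))) {t τ a : ℝ} (ht : 1 ≤ t) (hta : t * a = τ - 1)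
    {x₀ x₁ y x₂ e : H} (hy : y = x₁ + a • (x₁ - x₀)) (hx₂ : x₂ = y - s • (gradient f y + e)) :
    s * t ^ 2 * (f x₂ - f p) + 1 / 2 * ‖x₁ + t • (x₂ - x₁) - p‖ ^ 2
      + s ^ 2 * (t * (t - 1)) / 2 * ‖gradient f y - gradient f x₁‖ ^ 2
      + s ^ 2 * t ^ 2 / 2 * ‖gradient f x₂‖ ^ 2
    ≤ s * (t * (t - 1)) * (f x₁ - f p) + 1 / 2 * ‖x₀ + τ • (x₁ - x₀) - p‖ ^ 2
      + inner ℝ ((s ^ 2 * t ^ 2) • (gradient f y - gradient f (y - s • gradient f y))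
          - (s * t) • (x₀ + τ • (x₁ - x₀) - p)) e
      + 3 / 2 * (s * t) ^ 2 * ‖e‖ ^ 2 := by
  have hs0 := hs.1
  have hL' : (0 : ℝ) < L := hL
  have hsL : s / 2 ≤ 1 / (2 * L) := by
    calc s / 2 ≤ (1 / L) / 2 := by linarith [hs.2]
      _ = 1 / (2 * L) := by field_simp
  have hA := add_inner_gradient_le hconv hdiff y p
  have hB := add_inner_gradient_add_sq_le hconv hdiff hL hLip y x₁
  have hC := add_inner_gradient_add_sq_le hconv hdiff hL hLip x₂ y
  set G := gradient f y
  -- The relation `t a = τ - 1` makes the anchored vector a combination of `y - x₁` and `y - p`.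
  -- These are the directions in which `hA` and `hB` test the gradient at `y`.
  set Z := x₀ + τ • (x₁ - x₀) - p with hZdef
  have hyx : t • (y - x₁) = (τ - 1) • (x₁ - x₀) := by
    rw [hy, add_sub_cancel_left, smul_smul, hta]
  have hZ : Z = (t - 1) • (y - x₁) + (y - p) := by
    have : (t - 1) • (y - x₁) = (τ - 1) • (x₁ - x₀) - (y - x₁) := by
      rw [sub_smul, hyx, one_smul]
    rw [this, hZdef, sub_smul, one_smul]
    abel
  have hz₂ : x₁ + t • (x₂ - x₁) - p = Z - (s * t) • (G + e) := by
    have : x₂ - x₁ = (y - x₁) - s • (G + e) := by rw [hx₂]; abel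
    rw [this, smul_sub, hyx, hZdef, sub_smul, one_smul, smul_smul, mul_comm t s]
    abel
  have hx₂' : x₂ + s • e = y - s • G := by rw [hx₂, smul_add]; abel
  have hD := inner_gradient_sub_le L hL hLip hs x₂ e
  rw [hx₂'] at hD
  have hyx₂ : y - x₂ = s • (G + e) := by rw [hx₂]; abel
  rw [hyx₂] at hC
  rw [← neg_sub y p] at hA
  rw [← neg_sub y x₁] at hB
  rw [hz₂]
  set G₁ := gradient f x₁
  set G₂ := gradient f x₂
  set G' := gradient f (y - s • G)
  have hB' : s / 2 * ‖G - G₁‖ ^ 2 ≤ 1 / (2 * L) * ‖G₁ - G‖ ^ 2 := by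
    rw [norm_sub_rev]; gcongr
  have hC' : s / 2 * ‖G - G₂‖ ^ 2 ≤ 1 / (2 * L) * ‖G - G₂‖ ^ 2 := by gcongr
  have hGG : ‖G - G₂‖ ^ 2 = ‖G‖ ^ 2 - 2 * inner ℝ G G₂ + ‖G₂‖ ^ 2 := norm_sub_sq_real _ _
  have hGe : ‖G + e‖ ^ 2 = ‖G‖ ^ 2 + 2 * inner ℝ G e + ‖e‖ ^ 2 := norm_add_sq_real _ _
  have hZe : ‖Z - (s * t) • (G + e)‖ ^ 2 = ‖Z‖ ^ 2
      - 2 * (s * t) * ((t - 1) * inner ℝ G (y - x₁) + inner ℝ G (y - p) + inner ℝ Z e)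
      + (s * t) ^ 2 * ‖G + e‖ ^ 2 := by
    rw [norm_sub_sq_real, real_inner_smul_right, norm_smul, mul_pow, Real.norm_eq_abs, sq_abs,
      inner_add_right]
    have : inner ℝ Z G = (t - 1) * inner ℝ G (y - x₁) + inner ℝ G (y - p) := by
      rw [real_inner_comm, hZ, inner_add_right, real_inner_smul_right]
    rw [this]
    ring
  rw [hZe, hGe, inner_sub_left (_ • (G - G')), real_inner_smul_left, real_inner_smul_left,
    inner_sub_left G G']
  rw [inner_neg_right] at hA hB
  rw [real_inner_smul_right, inner_add_right, real_inner_comm G G₂] at hC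
  rw [inner_sub_left] at hD
  rw [hGG] at hC hC'
  -- The weights `s t`, `s t (t - 1)` and `s t²` eliminate `f y`, as `t + t (t - 1) = t²`. The error
  -- coefficient `3/2` is `1/2` from the squared norm plus `1` from `hD`.
  have m1 := mul_le_mul_of_nonneg_left hA (by positivity : 0 ≤ s * t)
  have m2 := mul_le_mul_of_nonneg_left (add_le_add hB hB')
    (mul_nonneg hs0.le (mul_nonneg (by linarith) (by linarith)) : 0 ≤ s * (t * (t - 1)))
  have m3 := mul_le_mul_of_nonneg_left (add_le_add hC hC') (by positivity : 0 ≤ s * t ^ 2)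
  have m4 := mul_le_mul_of_nonneg_left hD (by positivity : 0 ≤ s ^ 2 * t ^ 2)
  linarith

/-- One step of the inertial method decreases the mechanical energy, up to a centred term and a
term that is quadratic in the error. -/
theorem mechanical_energy_step (hconv : ConvexOn ℝ Set.univ f) (hdiff : Differentiable ℝ f)
    {L : ℝ≥0} (hL : 0 < L) (hLip : LipschitzWith L (gradient f))
    {s : ℝ} (hs : s ∈ Set.Ioc 0 (1 / (L : ℝ))) {x₁ y x₂ e : H}
    (hx₂ : x₂ = y - s • (gradient f y + e)) :
    s * f x₂ + 1 / 2 * ‖x₂ - x₁‖ ^ 2 ≤ s * f x₁ + 1 / 2 * ‖y - x₁‖ ^ 2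
      + inner ℝ (s ^ 2 • gradient f y - s • (y - x₁)) e + s ^ 2 * ‖e‖ ^ 2 := by
  have hs0 := hs.1
  have hL' : (0 : ℝ) < L := hL
  have hsL : s * L ≤ 1 := by
    have := mul_le_mul_of_nonneg_right hs.2 hL'.le
    rwa [one_div_mul_cancel hL'.ne'] at this
  have hA := add_inner_gradient_le hconv hdiff y x₁
  have hB := le_add_inner_gradient_add_sq hdiff hLip y x₂
  set G := gradient f y
  have e1 : x₂ - y = -(s • (G + e)) := by rw [hx₂]; abel
  have e2 : x₂ - x₁ = (y - x₁) - s • (G + e) := by rw [hx₂]; abel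
  have hGe : ‖G + e‖ ^ 2 = ‖G‖ ^ 2 + 2 * inner ℝ G e + ‖e‖ ^ 2 := norm_add_sq_real _ _
  rw [← neg_sub y x₁, inner_neg_right] at hA
  rw [e1, inner_neg_right, norm_neg, real_inner_smul_right, norm_smul, mul_pow, Real.norm_eq_abs,
    sq_abs, inner_add_right, real_inner_self_eq_norm_sq] at hB
  rw [e2, norm_sub_sq_real, real_inner_smul_right, inner_add_right, real_inner_comm G (y - x₁),
    norm_smul, mul_pow, Real.norm_eq_abs, sq_abs, inner_sub_left (_ • G), real_inner_smul_left,
    real_inner_smul_left]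
  -- With `s L ≤ 1` the terms in `‖G‖²` cancel exactly; only terms containing `e` remain.
  have m1 := mul_le_mul_of_nonneg_left (add_le_add hA hB) hs0.le
  have m2 : (s * L) * (s ^ 2 * ‖G + e‖ ^ 2) ≤ 1 * (s ^ 2 * ‖G + e‖ ^ 2) := by gcongr
  rw [hGe] at *
  nlinarith [m1, m2]

end Energy

/-! ### A limit forced to vanish by the harmonic series. -/

section Sequences

/-- A positive limit would make the harmonic series converge. This is what turns `O` rates into `o`
rates. -/
theorem eq_zero_of_tendsto_of_summable_div {a : ℕ → ℝ} {c : ℝ} (ha0 : ∀ k, 0 ≤ a k)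
    (ha : Tendsto a atTop (𝓝 c)) (hsum : Summable fun k : ℕ => a k / (k + 1)) : c = 0 := by
  by_contra hc
  have hc0 : 0 < c := lt_of_le_of_ne (ge_of_tendsto' ha ha0) (Ne.symm hc)
  obtain ⟨N, hN⟩ := eventually_atTop.1 (ha.eventually (lt_mem_nhds (half_lt_self hc0)))
  have h1 : Summable fun k : ℕ => (c / 2) / ((k + N : ℕ) + 1 : ℝ) := by
    refine Summable.of_nonneg_of_le (fun k => by positivity) (fun k => ?_)
      ((summable_nat_add_iff N).2 hsum)
    have := (hN (k + N) (by omega)).le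
    gcongr
  have h2 : Summable fun k : ℕ => (1 : ℝ) / ((k + (N + 1) : ℕ) : ℝ) := by
    refine (h1.mul_left (2 / c)).congr fun k => ?_
    push_cast
    field_simp
    ring
  exact Real.not_summable_one_div_natCast ((summable_nat_add_iff (N + 1)).1 h2)

end Sequences

/-! ### Weak convergence, Opial's lemma and measurability of weak limits. -/

section Weak

variable {H : Type*} [NormedAddCommGroup H] [InnerProductSpace ℝ H] [CompleteSpace H]

theorem weaklyConverges_of_forall_inner {x : ℕ → H} {p : H}
    (h : ∀ v, Tendsto (fun k => inner ℝ v (x k)) atTop (𝓝 (inner ℝ v p))) :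
    WeaklyConverges x p := by
  refine (WeakBilin.tendsto_iff_forall_eval_tendsto (topDualPairing ℝ H).flip
    (fun a b hab => ?_)).2 fun φ => ?_
  · refine ext_inner_left ℝ fun v => ?_
    exact congrArg (fun l : StrongDual ℝ H →ₗ[ℝ] ℝ => l (InnerProductSpace.toDual ℝ H v)) hab
  · have := h ((InnerProductSpace.toDual ℝ H).symm φ)
    simp only [InnerProductSpace.toDual_symm_apply] at this
    exact this

/-- Bounded sequences of a separable Hilbert space have weakly convergent subsequences. -/
theorem exists_subseq_forall_inner_tendsto [TopologicalSpace.SeparableSpace H] {x : ℕ → H} {R : ℝ}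
    (hx : ∀ k, ‖x k‖ ≤ R) : ∃ (p : H) (φ : ℕ → ℕ), StrictMono φ ∧
      ∀ v, Tendsto (fun k => inner ℝ v (x (φ k))) atTop (𝓝 (inner ℝ v p)) := by
  obtain ⟨ψ, -, φ, hφ, hlim⟩ := WeakDual.isSeqCompact_closedBall ℝ H 0 R
    (x := fun k => StrongDual.toWeakDual (InnerProductSpace.toDual ℝ H (x k)))
    (fun k => by simpa using hx k)
  refine ⟨(InnerProductSpace.toDual ℝ H).symm (WeakDual.toStrongDual ψ), φ, hφ, fun v => ?_⟩
  have h1 := ((WeakDual.eval_continuous v).tendsto ψ).comp hlim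
  rw [real_inner_comm, InnerProductSpace.toDual_symm_apply]
  refine h1.congr fun k => ?_
  rw [real_inner_comm]
  rfl

/-- Opial's lemma: convergence of the distances to a dense subset of the target set. -/
theorem exists_weak_limit [TopologicalSpace.SeparableSpace H] {x : ℕ → H} {S T : Set H}
    (hS : S.Nonempty) (hST : S ⊆ closure T)
    (hT : ∀ p ∈ T, ∃ c, Tendsto (fun k => ‖x k - p‖) atTop (𝓝 c))
    (hcluster : ∀ (p : H) (φ : ℕ → ℕ), StrictMono φ →
      (∀ v, Tendsto (fun k => inner ℝ v (x (φ k))) atTop (𝓝 (inner ℝ v p))) → p ∈ S) :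
    ∃ p ∈ S, ∀ v, Tendsto (fun k => inner ℝ v (x k)) atTop (𝓝 (inner ℝ v p)) := by
  have hconv : ∀ p ∈ S, ∃ c, Tendsto (fun k => ‖x k - p‖) atTop (𝓝 c) := by
    intro p hp
    refine cauchySeq_tendsto_of_complete (Metric.cauchySeq_iff'.2 fun ε hε => ?_)
    obtain ⟨q, hq, hpq⟩ := Metric.mem_closure_iff.1 (hST hp) (ε / 4) (by positivity)
    obtain ⟨c, hc⟩ := hT q hq
    obtain ⟨N, hN⟩ := Metric.cauchySeq_iff'.1 hc.cauchySeq (ε / 4) (by positivity)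
    refine ⟨N, fun n hn => ?_⟩
    have h1 := hN n hn
    rw [dist_eq_norm] at hpq
    rw [Real.dist_eq] at h1 ⊢
    -- Distances are 1-Lipschitz in the anchor, uniformly in `k`, so their convergence extends from
    -- `T` to its closure.
    have key : ∀ k, |‖x k - p‖ - ‖x k - q‖| ≤ ‖p - q‖ := fun k => by
      refine (abs_norm_sub_norm_le _ _).trans_eq ?_
      rw [sub_sub_sub_cancel_left, norm_sub_rev]
    have h2 := abs_le.1 (key n)
    have h3 := abs_le.1 (key N)
    rw [abs_lt] at h1 ⊢
    constructor <;> linarith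
  obtain ⟨p₀, hp₀⟩ := hS
  obtain ⟨R, hR⟩ : ∃ R, ∀ k, ‖x k‖ ≤ R := by
    obtain ⟨c, hc⟩ := hconv p₀ hp₀
    obtain ⟨R, hR⟩ := hc.bddAbove_range
    refine ⟨R + ‖p₀‖, fun k => ?_⟩
    have h1 : ‖x k - p₀‖ ≤ R := hR ⟨k, rfl⟩
    have h2 := norm_le_norm_sub_add (x k) p₀
    linarith
  obtain ⟨p, φ, hφ, hp⟩ := exists_subseq_forall_inner_tendsto hR
  have hpS := hcluster p φ hφ hp
  refine ⟨p, hpS, fun v => tendsto_of_subseq_tendsto fun ns hns => ?_⟩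
  obtain ⟨q, ψ, hψ, hq⟩ := exists_subseq_forall_inner_tendsto (x := fun k => x (ns k))
    fun k => hR _
  have hnsψ : Tendsto (fun k => ns (ψ k)) atTop atTop := hns.comp hψ.tendsto_atTop
  have hqS : q ∈ S := by
    obtain ⟨χ, hχ, hmono⟩ := strictMono_subseq_of_tendsto_atTop hnsψ
    exact hcluster q _ hmono fun v => (hq v).comp hχ.tendsto_atTop
  have hpq : p = q := by
    obtain ⟨c, hc⟩ := hconv p hpS
    obtain ⟨d, hd⟩ := hconv q hqS
    -- By polarization this inner product is determined by the two distances, so it converges along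
    -- the full sequence. Its limits along the two subsequences then give `⟨p - q, p⟩ = ⟨p - q, q⟩`.
    have hlim : Tendsto (fun k => inner ℝ (p - q) (x k)) atTop
        (𝓝 ((‖p‖ ^ 2 - ‖q‖ ^ 2 - (c ^ 2 - d ^ 2)) / 2)) := by
      refine (((tendsto_const_nhds (x := ‖p‖ ^ 2 - ‖q‖ ^ 2)).sub
        ((hc.pow 2).sub (hd.pow 2))).div_const 2).congr fun k => ?_
      rw [norm_sub_sq_real, norm_sub_sq_real, inner_sub_left, real_inner_comm p, real_inner_comm q]
      ring
    have h1 := tendsto_nhds_unique (hp (p - q)) (hlim.comp hφ.tendsto_atTop)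
    have h2 := tendsto_nhds_unique (hq (p - q)) (hlim.comp hnsψ)
    rw [← sub_eq_zero, ← inner_self_eq_zero (𝕜 := ℝ), inner_sub_right, h1, h2, sub_self]
  exact ⟨ψ, hpq ▸ hq v⟩

/-- Weakly measurable maps into a separable Hilbert space are measurable. -/
theorem measurable_of_forall_measurable_inner [TopologicalSpace.SeparableSpace H]
    [MeasurableSpace H] [BorelSpace H] {Ω : Type*} [MeasurableSpace Ω] {Y : Ω → H}
    (hY : ∀ v, Measurable fun ω => inner ℝ v (Y ω)) : Measurable Y := by
  -- Countably many inner products separate points. A continuous injection of a Polish space is a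
  -- measurable embedding (Lusin-Souslin), so measurability can be tested after `ι`.
  let ι : H → ℕ → ℝ := fun x n => inner ℝ (TopologicalSpace.denseSeq H n) x
  have hι : Continuous ι := by fun_prop
  have hinj : Function.Injective ι := by
    intro a b hab
    have : (fun v : H => inner ℝ v a) = fun v : H => inner ℝ v b :=
      (TopologicalSpace.denseRange_denseSeq H).equalizer (by fun_prop) (by fun_prop)
        (funext fun n => congrFun hab n)
    exact ext_inner_left ℝ fun v => congrFun this v
  refine (hι.measurableEmbedding hinj).measurable_comp_iff.1 ?_
  exact measurable_pi_lambda _ fun n => hY _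

/-- If a sequence of random vectors converges weakly to a point of `S` almost surely, then its
limit can be chosen to be an `S`-valued random vector. -/
theorem exists_measurable_weak_limit [TopologicalSpace.SeparableSpace H] [MeasurableSpace H]
    [BorelSpace H] {Ω : Type*} [MeasurableSpace Ω] {μ : Measure Ω} {X : ℕ → Ω → H}
    (hX : ∀ k, Measurable (X k)) {S : Set H} (hS : S.Nonempty)
    (hlim : ∀ᵐ ω ∂μ, ∃ p ∈ S,
      ∀ v, Tendsto (fun k => inner ℝ v (X k ω)) atTop (𝓝 (inner ℝ v p))) :
    ∃ Y : Ω → H, Measurable Y ∧ (∀ ω, Y ω ∈ S) ∧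
      ∀ᵐ ω ∂μ, WeaklyConverges (fun k => X k ω) (Y ω) := by
  classical
  obtain ⟨p₀, hp₀⟩ := hS
  -- The exceptional set is enlarged to a measurable null set, on which the limit is redefined as
  -- `p₀`.
  obtain ⟨N, hNsub, hNm, hN⟩ := exists_measurable_superset_of_null (ae_iff.1 hlim)
  have hgood : ∀ ω, ω ∉ N → ∃ p ∈ S,
      ∀ v, Tendsto (fun k => inner ℝ v (X k ω)) atTop (𝓝 (inner ℝ v p)) := fun ω hω => by
    by_contra h
    exact hω (hNsub h)
  choose! Y hYS hY using hgood
  have hZ : Measurable (N.indicator (fun _ => p₀) + Nᶜ.indicator Y) := by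
    refine (measurable_const.indicator hNm).add (measurable_of_forall_measurable_inner fun v => ?_)
    refine measurable_of_tendsto_metrizable
      (f := fun k ω => inner ℝ v (Nᶜ.indicator (X k) ω))
      (fun k => ((hX k).indicator hNm.compl).const_inner) (tendsto_pi_nhds.2 fun ω => ?_)
    by_cases hω : ω ∈ N
    · simp [hω]
    · simpa [hω] using hY ω hω v
  refine ⟨_, hZ, fun ω => ?_, ?_⟩
  · by_cases hω : ω ∈ N
    · simpa [hω] using hp₀
    · simpa [hω] using hYS ω hω
  · filter_upwards [measure_eq_zero_iff_ae_notMem.1 hN] with ω hω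
    simpa [hω] using weaklyConverges_of_forall_inner (hY ω hω)

end Weak

/-! ### Deterministic trajectories and transfer from `x` to `y`. -/

section Trajectory

theorem potential_nonneg {X : Type*} {f : X → ℝ} {s : ℕ → ℝ} {x : ℕ → X} {p : X}
    (hs : ∀ k, 0 < s k) (hp : p ∈ argmin f) (k : ℕ) :
    0 ≤ s (k + 1) * (f (x (k + 1)) - f p) :=
  mul_nonneg (hs _).le (sub_nonneg.2 (hp _))

/-- The quantity controlling both the values and the increments along a trajectory. -/
noncomputable def localResidual {H : Type*} [NormedAddCommGroup H] (f : H → ℝ) (s : ℕ → ℝ) (p : H)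
    (x : ℕ → H) (k : ℕ) : ℝ :=
  s (k + 1) * (f (x (k + 1)) - f p) + ‖x (k + 1) - x k‖ ^ 2

theorem localResidual_nonneg {H : Type*} [NormedAddCommGroup H] {f : H → ℝ} {s : ℕ → ℝ} {x : ℕ → H}
    {p : H} (hs : ∀ k, 0 < s k) (hp : p ∈ argmin f) (k : ℕ) : 0 ≤ localResidual f s p x k :=
  add_nonneg (potential_nonneg hs hp k) (by positivity)

/-- The rescaled mechanical energy. -/
noncomputable def mechanicalEnergy {H : Type*} [NormedAddCommGroup H] (f : H → ℝ) (s : ℕ → ℝ)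
    (p : H) (x : ℕ → H) (k : ℕ) : ℝ :=
  (k : ℝ) ^ 2 * (s (k + 1) * (f (x (k + 1)) - f p) + 1 / 2 * ‖x (k + 1) - x k‖ ^ 2)

/-- The mechanical energy is comparable to `k²` times the residual. Summability of `(k + 1)` times
the residual therefore forces the limit of the energy to be zero. -/
theorem localResidual_summable_and_tendsto {H : Type*} [NormedAddCommGroup H] {f : H → ℝ} {s : ℕ → ℝ}
    {x : ℕ → H} {p : H} {α : ℝ} (hs : ∀ k, 0 < s k) (hp : p ∈ argmin f) (hα : 1 < α)
    (hpot : Summable fun k : ℕ => (k + 1) * s (k + 1) * (f (x (k + 1)) - f p))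
    (hkin : Summable fun k : ℕ => 1 / 2 * ((α - 1) * (2 * k + 1 - α)) * ‖x (k + 1) - x k‖ ^ 2)
    (hE : ∃ c, Tendsto (mechanicalEnergy f s p x) atTop (𝓝 c)) :
    Summable (fun k : ℕ => (k + 1) * localResidual f s p x k) ∧
      Tendsto (fun k : ℕ => ((k : ℝ) + 1) ^ 2 * localResidual f s p x k) atTop (𝓝 0) := by
  have hα1 : 0 < α - 1 := by linarith
  have hkin' : Summable fun k : ℕ => ((k : ℝ) + 1) * ‖x (k + 1) - x k‖ ^ 2 := by
    refine Summable.of_norm_bounded_eventually_nat (hkin.mul_left (2 / (α - 1))) ?_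
    -- For `k ≥ α` the weight satisfies `2 k + 1 - α ≥ k + 1`.
    filter_upwards [eventually_ge_atTop ⌈α⌉₊] with k hk
    have hk' : α ≤ k := Nat.ceil_le.1 hk
    rw [Real.norm_of_nonneg (by positivity), ← mul_assoc]
    gcongr
    have : 2 / (α - 1) * (1 / 2 * ((α - 1) * (2 * k + 1 - α))) = 2 * k + 1 - α := by field_simp
    rw [this]
    linarith
  have hsum : Summable fun k : ℕ => (k + 1) * localResidual f s p x k := by
    refine (hpot.add hkin').congr fun k => ?_
    simp only [localResidual]
    ring
  refine ⟨hsum, ?_⟩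
  obtain ⟨c, hc⟩ := hE
  have hle : ∀ k : ℕ, mechanicalEnergy f s p x k ≤ (k : ℝ) ^ 2 * localResidual f s p x k := fun k => by
    simp only [mechanicalEnergy, localResidual]
    gcongr
    have : 0 ≤ ‖x (k + 1) - x k‖ ^ 2 := by positivity
    linarith
  have hge : ∀ k : ℕ, (k : ℝ) ^ 2 * localResidual f s p x k ≤ 2 * mechanicalEnergy f s p x k := fun k => by
    have := mul_nonneg (sq_nonneg (k : ℝ)) (potential_nonneg (x := x) hs hp k)
    simp only [mechanicalEnergy, localResidual]
    linarith
  have hE0 : ∀ k, 0 ≤ mechanicalEnergy f s p x k := fun k => by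
    have := mul_nonneg (sq_nonneg (k : ℝ)) (localResidual_nonneg (x := x) hs hp k)
    linarith [hge k]
  have hc0 : c = 0 := by
    refine eq_zero_of_tendsto_of_summable_div hE0 hc
      (Summable.of_nonneg_of_le (fun k => div_nonneg (hE0 k) (by positivity)) (fun k => ?_) hsum)
    rw [div_le_iff₀ (by positivity)]
    refine (hle k).trans ?_
    have := localResidual_nonneg (x := x) hs hp k
    have hk : (0 : ℝ) ≤ k := by positivity
    nlinarith
  subst hc0
  refine squeeze_zero' (Eventually.of_forall fun k =>
    mul_nonneg (by positivity) (localResidual_nonneg hs hp k)) ?_ (by simpa using hc.const_mul 8)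
  filter_upwards [eventually_ge_atTop 1] with k hk
  have hk' : (1 : ℝ) ≤ k := by exact_mod_cast hk
  have hr := localResidual_nonneg (x := x) hs hp k
  calc ((k : ℝ) + 1) ^ 2 * localResidual f s p x k ≤ (4 * (k : ℝ) ^ 2) * localResidual f s p x k := by
        gcongr
        nlinarith
    _ ≤ 8 * mechanicalEnergy f s p x k := by linarith [hge k]

variable {H : Type*} [NormedAddCommGroup H] [InnerProductSpace ℝ H] [CompleteSpace H] {f : H → ℝ}

/-- Deterministic trajectories of the inexact method, in terms of the Nesterov sequence `x`. -/
structure IsTrajectory (f : H → ℝ) (s : ℕ → ℝ) (α : ℝ) (e y x : ℕ → H) : Prop where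
  y_eq : ∀ k : ℕ, y (k + 1) = x (k + 1) + (1 - α / (k + 1 : ℝ)) • (x (k + 1) - x k)
  x_eq : ∀ k : ℕ, x (k + 2) = y (k + 1) - s (k + 1) • (gradient f (y (k + 1)) + e (k + 1))

/-- The energy anchored at `p`. -/
noncomputable def anchoredEnergy (f : H → ℝ) (s : ℕ → ℝ) (α : ℝ) (p : H) (x : ℕ → H) (k : ℕ) : ℝ :=
  s (k + 1) * (k / (α - 1)) ^ 2 * (f (x (k + 1)) - f p)
    + 1 / 2 * ‖x k + (k / (α - 1)) • (x (k + 1) - x k) - p‖ ^ 2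

variable {s : ℕ → ℝ} {α : ℝ} {e y x : ℕ → H} {L : ℝ≥0} {p : H}

/-- With `t = (k + 1) / (α - 1)` and `τ = k / (α - 1)` one has `τ² - t (t - 1) = ((α - 3)(k + 1) +
1) / (α - 1)²`. This surplus is the dissipation of values, positive because `α > 3`. -/
theorem IsTrajectory.anchoredEnergy_succ_le (hT : IsTrajectory f s α e y x)
    (hconv : ConvexOn ℝ Set.univ f) (hdiff : Differentiable ℝ f)
    (hL : 0 < L) (hLip : LipschitzWith L (gradient f)) (hs : ∀ k, s k ∈ Set.Ioc 0 (1 / (L : ℝ)))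
    (hs_anti : Antitone s) (hα : 3 < α) (hp : p ∈ argmin f) {k : ℕ} (hk : 2 * α ≤ k) :
    anchoredEnergy f s α p x (k + 1)
      + ((α - 3) / (α - 1) ^ 2 * ((k + 1) * s (k + 1) * (f (x (k + 1)) - f p))
        + 1 / (4 * (α - 1) ^ 2) * (((k + 1) * s (k + 1)) ^ 2
            * ‖gradient f (y (k + 1)) - gradient f (x (k + 1))‖ ^ 2)
        + 1 / (4 * (α - 1) ^ 2) * (((k + 1) * s (k + 1)) ^ 2 * ‖gradient f (x (k + 2))‖ ^ 2))
    ≤ anchoredEnergy f s α p x k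
      + inner ℝ ((s (k + 1) ^ 2 * ((k + 1) / (α - 1)) ^ 2) • (gradient f (y (k + 1))
            - gradient f (y (k + 1) - s (k + 1) • gradient f (y (k + 1))))
          - (s (k + 1) * ((k + 1) / (α - 1))) • (x k + (k / (α - 1)) • (x (k + 1) - x k) - p))
          (e (k + 1))
      + 3 / 2 * (1 / (α - 1) ^ 2) * ((k + 1) * s (k + 1)) ^ 2 * ‖e (k + 1)‖ ^ 2 := by
  have hα1 : 0 < α - 1 := by linarith
  have hk1 : (0 : ℝ) < k + 1 := by positivity
  have ht : 1 ≤ ((k : ℝ) + 1) / (α - 1) := by rw [le_div_iff₀ hα1]; linarith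
  have hta : ((k : ℝ) + 1) / (α - 1) * (1 - α / (k + 1)) = k / (α - 1) - 1 := by
    field_simp
    ring
  have key := anchored_energy_step hconv hdiff hL hLip (p := p) (hs (k + 1)) ht hta (hT.y_eq k)
    (hT.x_eq k)
  have hsk := (hs (k + 1)).1
  have hh₁ : 0 ≤ f (x (k + 1)) - f p := sub_nonneg.2 (hp _)
  have hh₂ : 0 ≤ f (x (k + 2)) - f p := sub_nonneg.2 (hp _)
  have hmono : s (k + 2) * (((k : ℝ) + 1) / (α - 1)) ^ 2 * (f (x (k + 2)) - f p)
      ≤ s (k + 1) * (((k : ℝ) + 1) / (α - 1)) ^ 2 * (f (x (k + 2)) - f p) := by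
    have := hs_anti (Nat.le_succ (k + 1))
    gcongr
  have hpot : s (k + 1) * (((k : ℝ) + 1) / (α - 1) * (((k : ℝ) + 1) / (α - 1) - 1))
        * (f (x (k + 1)) - f p)
        + (α - 3) / (α - 1) ^ 2 * ((k + 1) * s (k + 1) * (f (x (k + 1)) - f p))
      ≤ s (k + 1) * (k / (α - 1)) ^ 2 * (f (x (k + 1)) - f p) := by
    have : s (k + 1) * (k / (α - 1)) ^ 2 * (f (x (k + 1)) - f p)
        - (s (k + 1) * (((k : ℝ) + 1) / (α - 1) * (((k : ℝ) + 1) / (α - 1) - 1))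
        * (f (x (k + 1)) - f p)
        + (α - 3) / (α - 1) ^ 2 * ((k + 1) * s (k + 1) * (f (x (k + 1)) - f p)))
        = s (k + 1) * (1 / (α - 1) ^ 2) * (f (x (k + 1)) - f p) := by
      field_simp
      ring
    have h0 : 0 ≤ s (k + 1) * (1 / (α - 1) ^ 2) * (f (x (k + 1)) - f p) := by positivity
    linarith
  have hgrad₁ : 1 / (4 * (α - 1) ^ 2) * (((k + 1) * s (k + 1)) ^ 2
            * ‖gradient f (y (k + 1)) - gradient f (x (k + 1))‖ ^ 2)
      ≤ s (k + 1) ^ 2 * (((k : ℝ) + 1) / (α - 1) * (((k : ℝ) + 1) / (α - 1) - 1)) / 2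
            * ‖gradient f (y (k + 1)) - gradient f (x (k + 1))‖ ^ 2 := by
    -- The factor `k + 3 - 2 α` in this difference is why the inequality is restricted to `k ≥ 2 α`.
    have h1 : s (k + 1) ^ 2 * (((k : ℝ) + 1) / (α - 1) * (((k : ℝ) + 1) / (α - 1) - 1)) / 2
        - 1 / (4 * (α - 1) ^ 2) * ((k + 1) * s (k + 1)) ^ 2
        = s (k + 1) ^ 2 * (k + 1) * (k + 3 - 2 * α) / (4 * (α - 1) ^ 2) := by
      field_simp
      ring
    have h2 : 0 ≤ s (k + 1) ^ 2 * (k + 1) * (k + 3 - 2 * α) / (4 * (α - 1) ^ 2) :=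
      div_nonneg (mul_nonneg (by positivity) (by linarith)) (by positivity)
    rw [← mul_assoc]
    gcongr
    linarith
  have hgrad₂ : 1 / (4 * (α - 1) ^ 2) * (((k + 1) * s (k + 1)) ^ 2 * ‖gradient f (x (k + 2))‖ ^ 2)
      ≤ s (k + 1) ^ 2 * (((k : ℝ) + 1) / (α - 1)) ^ 2 / 2 * ‖gradient f (x (k + 2))‖ ^ 2 := by
    have h1 : s (k + 1) ^ 2 * (((k : ℝ) + 1) / (α - 1)) ^ 2 / 2
        = 2 * (1 / (4 * (α - 1) ^ 2) * ((k + 1) * s (k + 1)) ^ 2) := by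
      field_simp
      ring
    rw [← mul_assoc, h1]
    refine mul_le_mul_of_nonneg_right ?_ (sq_nonneg _)
    have : 0 ≤ 1 / (4 * (α - 1) ^ 2) * ((k + 1) * s (k + 1)) ^ 2 := by positivity
    linarith
  have herr : 3 / 2 * (s (k + 1) * (((k : ℝ) + 1) / (α - 1))) ^ 2 * ‖e (k + 1)‖ ^ 2
      = 3 / 2 * (1 / (α - 1) ^ 2) * ((k + 1) * s (k + 1)) ^ 2 * ‖e (k + 1)‖ ^ 2 := by
    field_simp
  simp only [anchoredEnergy, Nat.cast_add, Nat.cast_one]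
  rw [show k + 1 + 1 = k + 2 from rfl]
  linarith

/-- The one-step bound is scaled by `(k + 1)²`. Friction leaves `k² - (k + 1 - α)² = (α - 1)(2 k + 1
- α)` on the kinetic part, and the growth of the weight leaves `2 k + 1` on the potential part. -/
theorem IsTrajectory.mechanicalEnergy_succ_le (hT : IsTrajectory f s α e y x)
    (hconv : ConvexOn ℝ Set.univ f) (hdiff : Differentiable ℝ f)
    (hL : 0 < L) (hLip : LipschitzWith L (gradient f)) (hs : ∀ k, s k ∈ Set.Ioc 0 (1 / (L : ℝ)))
    (hs_anti : Antitone s) (hp : p ∈ argmin f) (k : ℕ) :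
    mechanicalEnergy f s p x (k + 1)
      + 1 / 2 * ((α - 1) * (2 * k + 1 - α)) * ‖x (k + 1) - x k‖ ^ 2
    ≤ mechanicalEnergy f s p x k + (2 * k + 1) * s (k + 1) * (f (x (k + 1)) - f p)
      + inner ℝ (((k : ℝ) + 1) ^ 2 • (s (k + 1) ^ 2 • gradient f (y (k + 1))
        - s (k + 1) • (y (k + 1) - x (k + 1)))) (e (k + 1))
      + 1 * ((k + 1) * s (k + 1)) ^ 2 * ‖e (k + 1)‖ ^ 2 := by
  have hk1 : (0 : ℝ) < k + 1 := by positivity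
  have key := mechanical_energy_step hconv hdiff hL hLip (hs (k + 1)) (x₁ := x (k + 1)) (hT.x_eq k)
  have hh₂ : 0 ≤ f (x (k + 2)) - f p := sub_nonneg.2 (hp _)
  have hmono : s (k + 2) * (f (x (k + 2)) - f p) ≤ s (k + 1) * (f (x (k + 2)) - f p) := by
    have := hs_anti (Nat.le_succ (k + 1))
    gcongr
  have hyx : ((k : ℝ) + 1) ^ 2 * ‖y (k + 1) - x (k + 1)‖ ^ 2
      = (k + 1 - α) ^ 2 * ‖x (k + 1) - x k‖ ^ 2 := by
    rw [hT.y_eq k, add_sub_cancel_left, norm_smul, mul_pow, Real.norm_eq_abs, sq_abs]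
    field_simp
  have key' := mul_le_mul_of_nonneg_left (add_le_add key hmono)
    (by positivity : (0 : ℝ) ≤ (k + 1) ^ 2)
  simp only [mechanicalEnergy, Nat.cast_add, Nat.cast_one]
  rw [show k + 1 + 1 = k + 2 from rfl, real_inner_smul_left]
  linarith

theorem IsTrajectory.norm_y_sub_le (hT : IsTrajectory f s α e y x) (hα : 0 ≤ α) (k : ℕ) :
    ‖y (k + 1) - x (k + 1)‖ ≤ (1 + α) * ‖x (k + 1) - x k‖ := by
  rw [hT.y_eq k, add_sub_cancel_left, norm_smul]
  gcongr
  have h1 : α / (k + 1 : ℝ) ≤ α := div_le_self hα (by linarith [Nat.cast_nonneg (α := ℝ) k])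
  have h2 : 0 ≤ α / (k + 1 : ℝ) := by positivity
  rw [Real.norm_eq_abs, abs_le]
  constructor <;> linarith

/-- The descent lemma from `x` to `y` produces a cross term. Young's inequality absorbs it through
`norm_gradient_sq_le`, and `s L ≤ 1` removes `L`. -/
theorem IsTrajectory.potential_y_le (hT : IsTrajectory f s α e y x)
    (hconv : ConvexOn ℝ Set.univ f) (hdiff : Differentiable ℝ f)
    (hL : 0 < L) (hLip : LipschitzWith L (gradient f)) (hs : ∀ k, s k ∈ Set.Ioc 0 (1 / (L : ℝ)))
    (hα : 0 ≤ α) (hp : p ∈ argmin f) (k : ℕ) :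
    s (k + 1) * (f (y (k + 1)) - f p) ≤ (2 + (1 + α) ^ 2) * localResidual f s p x k := by
  have hL' : (0 : ℝ) < L := hL
  have hs0 := (hs (k + 1)).1
  have hsL : s (k + 1) * L ≤ 1 := by
    have := mul_le_mul_of_nonneg_right (hs (k + 1)).2 hL'.le
    rwa [one_div_mul_cancel hL'.ne'] at this
  have h1 := le_add_inner_gradient_add_sq hdiff hLip (x (k + 1)) (y (k + 1))
  have h2 := norm_gradient_sq_le hconv hdiff hL hLip hp (x (k + 1))
  have h3 := real_inner_le_norm (gradient f (x (k + 1))) (y (k + 1) - x (k + 1))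
  have h4 : ‖gradient f (x (k + 1))‖ * ‖y (k + 1) - x (k + 1)‖
      ≤ (f (x (k + 1)) - f p) + L / 2 * ‖y (k + 1) - x (k + 1)‖ ^ 2 := by
    have h5 : 0 ≤ (‖gradient f (x (k + 1))‖ - L * ‖y (k + 1) - x (k + 1)‖) ^ 2 := sq_nonneg _
    have : 2 * L * (‖gradient f (x (k + 1))‖ * ‖y (k + 1) - x (k + 1)‖)
        ≤ 2 * L * ((f (x (k + 1)) - f p) + L / 2 * ‖y (k + 1) - x (k + 1)‖ ^ 2) := by
      linarith
    exact le_of_mul_le_mul_left this (by positivity)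
  have h6 : s (k + 1) * (f (y (k + 1)) - f p)
      ≤ 2 * (s (k + 1) * (f (x (k + 1)) - f p)) + ‖y (k + 1) - x (k + 1)‖ ^ 2 := by
    have h7 : f (y (k + 1)) - f p
      ≤ 2 * (f (x (k + 1)) - f p) + L * ‖y (k + 1) - x (k + 1)‖ ^ 2 := by linarith
    have h8 := mul_le_mul_of_nonneg_left h7 hs0.le
    have h9 : s (k + 1) * L * ‖y (k + 1) - x (k + 1)‖ ^ 2 ≤ 1 * ‖y (k + 1) - x (k + 1)‖ ^ 2 := by
      gcongr
    linarith
  have h10 : ‖y (k + 1) - x (k + 1)‖ ^ 2 ≤ (1 + α) ^ 2 * ‖x (k + 1) - x k‖ ^ 2 := by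
    rw [← mul_pow]
    gcongr
    exact hT.norm_y_sub_le hα k
  have h11 : 0 ≤ (1 + α) ^ 2 * (s (k + 1) * (f (x (k + 1)) - f p)) :=
    mul_nonneg (by positivity) (mul_nonneg hs0.le (sub_nonneg.2 (hp _)))
  simp only [localResidual]
  have : 0 ≤ ‖x (k + 1) - x k‖ ^ 2 := by positivity
  linarith

theorem IsTrajectory.norm_y_succ_sub_sq_le (hT : IsTrajectory f s α e y x)
    (hs : ∀ k, 0 < s k) (hα : 0 ≤ α) (hp : p ∈ argmin f) (k : ℕ) :
    ‖y (k + 2) - y (k + 1)‖ ^ 2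
      ≤ 2 * (2 + α) ^ 2 * (localResidual f s p x (k + 1) + localResidual f s p x k) := by
  have h1 := hT.norm_y_sub_le hα k
  have h2 := hT.norm_y_sub_le hα (k + 1)
  have h3 : ‖y (k + 2) - y (k + 1)‖ ≤ (2 + α) * (‖x (k + 2) - x (k + 1)‖ + ‖x (k + 1) - x k‖) := by
    have : y (k + 2) - y (k + 1)
        = (y (k + 2) - x (k + 2)) + (x (k + 2) - x (k + 1)) - (y (k + 1) - x (k + 1)) := by abel
    rw [this]
    refine (norm_sub_le _ _).trans ((add_le_add_left (norm_add_le _ _) _).trans ?_)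
    have := norm_nonneg (x (k + 1) - x k)
    linarith
  have hp1 := potential_nonneg (x := x) hs hp k
  have hp2 := potential_nonneg (x := x) hs hp (k + 1)
  calc ‖y (k + 2) - y (k + 1)‖ ^ 2
      ≤ ((2 + α) * (‖x (k + 2) - x (k + 1)‖ + ‖x (k + 1) - x k‖)) ^ 2 := by gcongr
    _ ≤ (2 + α) ^ 2 * (2 * (‖x (k + 2) - x (k + 1)‖ ^ 2 + ‖x (k + 1) - x k‖ ^ 2)) := by
        rw [mul_pow]
        gcongr
        exact add_sq_le
    _ = 2 * (2 + α) ^ 2 * (‖x (k + 2) - x (k + 1)‖ ^ 2 + ‖x (k + 1) - x k‖ ^ 2) := by ring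
    _ ≤ _ := by
        gcongr
        · exact le_add_of_nonneg_left hp2
        · exact le_add_of_nonneg_left hp1

end Trajectory

theorem iInf_eq_of_mem_argmin {X : Type*} {f : X → ℝ} {p : X} (hp : p ∈ argmin f) :
    ⨅ x, f x = f p :=
  le_antisymm (ciInf_le ⟨f p, by rintro _ ⟨z, rfl⟩; exact hp z⟩ p)
    (haveI : Nonempty X := ⟨p⟩; le_ciInf hp)

theorem tendsto_comp_of_tendsto_values {X : Type*} {f : X → ℝ} {s : ℕ → ℝ} {y : ℕ → X} {p : X}
    {σ : ℝ} (hσ : 0 < σ) (hs : ∀ k, σ ≤ s k)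
    (hp : p ∈ argmin f)
    (hlim : Tendsto (fun k : ℕ => s k * (k : ℝ) ^ 2 * (f (y k) - f p)) atTop (𝓝 0)) :
    Tendsto (fun k => f (y k)) atTop (𝓝 (f p)) := by
  have : Tendsto (fun k => f (y k) - f p) atTop (𝓝 0) := by
    refine squeeze_zero' (Eventually.of_forall fun k => sub_nonneg.2 (hp (y k))) ?_
      (by simpa using hlim.const_mul (1 / σ))
    filter_upwards [eventually_ge_atTop 1] with k hk
    have hk' : (1 : ℝ) ≤ k := by exact_mod_cast hk
    have h1 := sub_nonneg.2 (hp (y k))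
    rw [← div_eq_inv_mul, le_div_iff₀ hσ, mul_comm]
    gcongr
    calc σ ≤ s k * 1 := by simpa using hs k
      _ ≤ s k * (k : ℝ) ^ 2 := by
        have := hs k
        gcongr
        · linarith
        · exact one_le_pow₀ hk'
  simpa using this.add_const (f p)

/-! ### Rates, summability and distances along a trajectory. -/

section Conclusions

variable {H : Type*} [NormedAddCommGroup H] [InnerProductSpace ℝ H] [CompleteSpace H] {f : H → ℝ}
  {s : ℕ → ℝ} {α : ℝ} {e y x : ℕ → H} {L : ℝ≥0} {p : H}

theorem IsTrajectory.tendsto_values (hT : IsTrajectory f s α e y x)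
    (hconv : ConvexOn ℝ Set.univ f) (hdiff : Differentiable ℝ f)
    (hL : 0 < L) (hLip : LipschitzWith L (gradient f)) (hs : ∀ k, s k ∈ Set.Ioc 0 (1 / (L : ℝ)))
    (hα : 0 ≤ α) (hp : p ∈ argmin f)
    (hlim : Tendsto (fun k : ℕ => ((k : ℝ) + 1) ^ 2 * localResidual f s p x k) atTop (𝓝 0)) :
    Tendsto (fun k : ℕ => s k * (k : ℝ) ^ 2 * (f (y k) - f p)) atTop (𝓝 0) := by
  rw [← tendsto_add_atTop_iff_nat 1]
  refine squeeze_zero (fun k => ?_) (fun k => ?_)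
    (by simpa using hlim.const_mul (2 + (1 + α) ^ 2))
  · have := (hs (k + 1)).1
    have := sub_nonneg.2 (hp (y (k + 1)))
    positivity
  · have := hT.potential_y_le hconv hdiff hL hLip hs hα hp k
    push_cast
    calc s (k + 1) * ((k : ℝ) + 1) ^ 2 * (f (y (k + 1)) - f p)
        = ((k : ℝ) + 1) ^ 2 * (s (k + 1) * (f (y (k + 1)) - f p)) := by ring
      _ ≤ ((k : ℝ) + 1) ^ 2 * ((2 + (1 + α) ^ 2) * localResidual f s p x k) := by gcongr
      _ = _ := by ring

theorem IsTrajectory.values_isLittleO (hT : IsTrajectory f s α e y x)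
    (hconv : ConvexOn ℝ Set.univ f) (hdiff : Differentiable ℝ f)
    (hL : 0 < L) (hLip : LipschitzWith L (gradient f)) (hs : ∀ k, s k ∈ Set.Ioc 0 (1 / (L : ℝ)))
    (hα : 0 ≤ α) (hp : p ∈ argmin f)
    (hlim : Tendsto (fun k : ℕ => ((k : ℝ) + 1) ^ 2 * localResidual f s p x k) atTop (𝓝 0)) :
    (fun k : ℕ => f (y k) - ⨅ z, f z) =o[atTop] fun k : ℕ => 1 / (s k * (k : ℝ) ^ 2) := by
  rw [iInf_eq_of_mem_argmin hp]
  refine isLittleO_iff_exists_eq_mul.2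
    ⟨_, hT.tendsto_values hconv hdiff hL hLip hs hα hp hlim, ?_⟩
  filter_upwards [eventually_ge_atTop 1] with k hk
  have h1 := (hs k).1
  have h2 : (0 : ℝ) < k := by exact_mod_cast hk
  simp only [Pi.mul_apply]
  field_simp

theorem IsTrajectory.increments_isLittleO (hT : IsTrajectory f s α e y x) (hs : ∀ k, 0 < s k)
    (hα : 0 ≤ α) (hp : p ∈ argmin f)
    (hlim : Tendsto (fun k : ℕ => ((k : ℝ) + 1) ^ 2 * localResidual f s p x k) atTop (𝓝 0)) :
    (fun k : ℕ => ‖y k - y (k - 1)‖) =o[atTop] fun k : ℕ => 1 / (k : ℝ) := by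
  have hsq : Tendsto (fun k : ℕ => ((k : ℝ) * ‖y k - y (k - 1)‖) ^ 2) atTop (𝓝 0) := by
    -- The trajectory relations constrain `y` only from index `1` on, so the first controlled
    -- increment is `y 2 - y 1`.
    rw [← tendsto_add_atTop_iff_nat 2]
    have h1 := (hlim.comp (tendsto_add_atTop_nat 1)).add (hlim.const_mul 4)
    refine squeeze_zero (fun k => sq_nonneg _) (fun k => ?_)
      (by simpa using h1.const_mul (2 * (2 + α) ^ 2))
    have h2 := hT.norm_y_succ_sub_sq_le hs hα hp k
    have h3 := localResidual_nonneg (x := x) hs hp k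
    rw [mul_pow]
    calc ((k + 2 : ℕ) : ℝ) ^ 2 * ‖y (k + 2) - y (k + 1)‖ ^ 2
        ≤ ((k + 2 : ℕ) : ℝ) ^ 2 * (2 * (2 + α) ^ 2
          * (localResidual f s p x (k + 1) + localResidual f s p x k)) := by gcongr
      _ = 2 * (2 + α) ^ 2 * (((k + 1 : ℕ) + 1 : ℝ) ^ 2 * localResidual f s p x (k + 1)
          + ((k : ℝ) + 2) ^ 2 * localResidual f s p x k) := by push_cast; ring
      _ ≤ 2 * (2 + α) ^ 2 * (((k + 1 : ℕ) + 1 : ℝ) ^ 2 * localResidual f s p x (k + 1)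
          + 4 * (((k : ℝ) + 1) ^ 2 * localResidual f s p x k)) := by
          have hk : ((k : ℝ) + 2) ^ 2 ≤ 4 * ((k : ℝ) + 1) ^ 2 := by
            nlinarith [Nat.cast_nonneg (α := ℝ) k]
          rw [← mul_assoc 4]
          gcongr
      _ = _ := by simp
  have hlin : Tendsto (fun k : ℕ => (k : ℝ) * ‖y k - y (k - 1)‖) atTop (𝓝 0) := by
    refine (by simpa using hsq.sqrt : Tendsto _ _ _).congr fun k => ?_
    rw [Real.sqrt_sq (by positivity)]
  refine isLittleO_iff_exists_eq_mul.2 ⟨_, hlin, ?_⟩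
  filter_upwards [eventually_ge_atTop 1] with k hk
  have h2 : (0 : ℝ) < k := by exact_mod_cast hk
  simp only [Pi.mul_apply]
  field_simp

theorem IsTrajectory.summable_values (hT : IsTrajectory f s α e y x)
    (hconv : ConvexOn ℝ Set.univ f) (hdiff : Differentiable ℝ f)
    (hL : 0 < L) (hLip : LipschitzWith L (gradient f)) (hs : ∀ k, s k ∈ Set.Ioc 0 (1 / (L : ℝ)))
    (hα : 0 ≤ α) (hp : p ∈ argmin f)
    (hsum : Summable fun k : ℕ => (k + 1) * localResidual f s p x k) :
    Summable fun k : ℕ => k * s k * (f (y k) - ⨅ z, f z) := by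
  rw [iInf_eq_of_mem_argmin hp, ← summable_nat_add_iff 1]
  refine Summable.of_nonneg_of_le (fun k => ?_) (fun k => ?_)
    (hsum.mul_left (2 + (1 + α) ^ 2))
  · have := (hs (k + 1)).1
    have := sub_nonneg.2 (hp (y (k + 1)))
    positivity
  · have := hT.potential_y_le hconv hdiff hL hLip hs hα hp k
    push_cast
    calc ((k : ℝ) + 1) * s (k + 1) * (f (y (k + 1)) - f p)
        = ((k : ℝ) + 1) * (s (k + 1) * (f (y (k + 1)) - f p)) := by ring
      _ ≤ ((k : ℝ) + 1) * ((2 + (1 + α) ^ 2) * localResidual f s p x k) := by gcongr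
      _ = _ := by ring

theorem IsTrajectory.summable_increments (hT : IsTrajectory f s α e y x) (hs : ∀ k, 0 < s k)
    (hα : 0 ≤ α) (hp : p ∈ argmin f)
    (hsum : Summable fun k : ℕ => (k + 1) * localResidual f s p x k) :
    Summable fun k : ℕ => k * ‖y k - y (k - 1)‖ ^ 2 := by
  rw [← summable_nat_add_iff 2]
  have h1 := ((summable_nat_add_iff 1).2 hsum).add (hsum.mul_left 2)
  refine Summable.of_nonneg_of_le (fun k => by positivity) (fun k => ?_)
    (h1.mul_left (2 * (2 + α) ^ 2))
  have h2 := hT.norm_y_succ_sub_sq_le hs hα hp k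
  have h3 := localResidual_nonneg (x := x) hs hp k
  calc ((k + 2 : ℕ) : ℝ) * ‖y (k + 2) - y (k + 1)‖ ^ 2
      ≤ ((k + 2 : ℕ) : ℝ) * (2 * (2 + α) ^ 2
        * (localResidual f s p x (k + 1) + localResidual f s p x k)) := by gcongr
    _ = 2 * (2 + α) ^ 2 * (((k + 1 : ℕ) + 1 : ℝ) * localResidual f s p x (k + 1)
        + ((k : ℝ) + 2) * localResidual f s p x k) := by push_cast; ring
    _ ≤ 2 * (2 + α) ^ 2 * (((k + 1 : ℕ) + 1 : ℝ) * localResidual f s p x (k + 1)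
        + 2 * (((k : ℝ) + 1) * localResidual f s p x k)) := by
        rw [← mul_assoc 2 ((k : ℝ) + 1)]
        gcongr
        linarith [Nat.cast_nonneg (α := ℝ) k]

theorem summable_sq_mul_norm_gradient_sq {σ : ℝ} (hσ : 0 < σ) (hs : ∀ k, σ ≤ s k)
    (hsub : Summable fun k : ℕ => ((k + 1) * s (k + 1)) ^ 2
      * ‖gradient f (y (k + 1)) - gradient f (x (k + 1))‖ ^ 2)
    (hgrad : Summable fun k : ℕ => ((k + 1) * s (k + 1)) ^ 2 * ‖gradient f (x (k + 2))‖ ^ 2) :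
    Summable fun k : ℕ => (k : ℝ) ^ 2 * ‖gradient f (y k)‖ ^ 2 := by
  rw [← summable_nat_add_iff 2]
  refine Summable.of_nonneg_of_le (fun k => by positivity) (fun k => ?_)
    ((((summable_nat_add_iff 1).2 hsub).add (hgrad.mul_left 4)).mul_left (2 / σ ^ 2))
  have h1 : ‖gradient f (y (k + 2))‖ ^ 2
      ≤ 2 * (‖gradient f (y (k + 2)) - gradient f (x (k + 2))‖ ^ 2
        + ‖gradient f (x (k + 2))‖ ^ 2) := by
    refine le_trans ?_ add_sq_le
    have := norm_le_norm_sub_add (gradient f (y (k + 2))) (gradient f (x (k + 2)))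
    gcongr
  have h2 : σ ^ 2 * ((k : ℝ) + 2) ^ 2 ≤ (((k + 1 : ℕ) + 1) * s (k + 2)) ^ 2 := by
    rw [← mul_pow]
    have := hs (k + 2)
    push_cast
    have hk : (0 : ℝ) ≤ k := by positivity
    refine pow_le_pow_left₀ (by positivity) ?_ 2
    nlinarith
  -- The gradient at `x (k + 2)` carries the weight of step `k + 1`; the factor `4` comes from `k +
  -- 2 ≤ 2 (k + 1)`.
  have h3 : σ ^ 2 * ((k : ℝ) + 2) ^ 2 ≤ 4 * ((k + 1) * s (k + 1)) ^ 2 := by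
    rw [← mul_pow, show (4 : ℝ) = 2 ^ 2 by norm_num, ← mul_pow]
    have := hs (k + 1)
    have hk : (0 : ℝ) ≤ k := by positivity
    refine pow_le_pow_left₀ (by positivity) ?_ 2
    nlinarith
  rw [div_mul_eq_mul_div, le_div_iff₀ (by positivity)]
  push_cast at h2 ⊢
  calc ((k : ℝ) + 2) ^ 2 * ‖gradient f (y (k + 2))‖ ^ 2 * σ ^ 2
      = (σ ^ 2 * ((k : ℝ) + 2) ^ 2) * ‖gradient f (y (k + 2))‖ ^ 2 := by ring
    _ ≤ (σ ^ 2 * ((k : ℝ) + 2) ^ 2)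
      * (2 * (‖gradient f (y (k + 2)) - gradient f (x (k + 2))‖ ^ 2
        + ‖gradient f (x (k + 2))‖ ^ 2)) := by gcongr
    _ = 2 * ((σ ^ 2 * ((k : ℝ) + 2) ^ 2)
          * ‖gradient f (y (k + 2)) - gradient f (x (k + 2))‖ ^ 2
        + (σ ^ 2 * ((k : ℝ) + 2) ^ 2) * ‖gradient f (x (k + 2))‖ ^ 2) := by ring
    _ ≤ 2 * ((((k : ℝ) + 1 + 1) * s (k + 2)) ^ 2
          * ‖gradient f (y (k + 2)) - gradient f (x (k + 2))‖ ^ 2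
        + (4 * ((k + 1) * s (k + 1)) ^ 2) * ‖gradient f (x (k + 2))‖ ^ 2) := by gcongr
    _ = _ := by rw [mul_assoc 4]

/-- Along a trajectory, the distances to a minimizer converge with its anchored energy. -/
theorem IsTrajectory.exists_tendsto_norm_sub (hT : IsTrajectory f s α e y x) (hs : ∀ k, 0 < s k)
    (hα : 1 < α) (hp : p ∈ argmin f)
    (hlim : Tendsto (fun k : ℕ => ((k : ℝ) + 1) ^ 2 * localResidual f s p x k) atTop (𝓝 0))
    (hE : ∃ c, Tendsto (anchoredEnergy f s α p x) atTop (𝓝 c)) :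
    ∃ c, Tendsto (fun k => ‖y k - p‖) atTop (𝓝 c) := by
  have hα1 : 0 < α - 1 := by linarith
  obtain ⟨c, hc⟩ := hE
  have hpot : Tendsto (fun k : ℕ => s (k + 1) * (k / (α - 1)) ^ 2 * (f (x (k + 1)) - f p))
      atTop (𝓝 0) := by
    refine squeeze_zero (fun k => ?_) (fun k => ?_)
      (by simpa using hlim.const_mul (1 / (α - 1) ^ 2))
    · have := hs (k + 1)
      have := sub_nonneg.2 (hp (x (k + 1)))
      positivity
    · have h1 := potential_nonneg (x := x) hs hp k
      calc s (k + 1) * (k / (α - 1)) ^ 2 * (f (x (k + 1)) - f p)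
          = 1 / (α - 1) ^ 2 * ((k : ℝ) ^ 2 * (s (k + 1) * (f (x (k + 1)) - f p))) := by field_simp
        _ ≤ 1 / (α - 1) ^ 2 * (((k : ℝ) + 1) ^ 2 * localResidual f s p x k) := by
          refine mul_le_mul_of_nonneg_left (mul_le_mul ?_ ?_ h1 (by positivity)) (by positivity)
          · gcongr
            linarith
          · exact le_add_of_nonneg_right (sq_nonneg _)
  -- The potential part of the energy vanishes in the limit, so `‖z k - p‖` converges. Since `k ‖Δx‖
  -- → 0`, the points `y (k + 1)` and `z k` merge.
  let z : ℕ → H := fun k => x k + (k / (α - 1)) • (x (k + 1) - x k)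
  have hz : Tendsto (fun k => ‖z k - p‖) atTop (𝓝 (√(2 * (c - 0)))) := by
    refine (((hc.sub hpot).const_mul 2).sqrt).congr fun k => ?_
    have : 2 * (anchoredEnergy f s α p x k
        - s (k + 1) * (k / (α - 1)) ^ 2 * (f (x (k + 1)) - f p)) = ‖z k - p‖ ^ 2 := by
      simp only [anchoredEnergy, z]
      ring
    rw [this, Real.sqrt_sq (norm_nonneg _)]
  have hd : Tendsto (fun k : ℕ => ((k : ℝ) + 1) * ‖x (k + 1) - x k‖) atTop (𝓝 0) := by
    have h1 : Tendsto (fun k : ℕ => (((k : ℝ) + 1) * ‖x (k + 1) - x k‖) ^ 2) atTop (𝓝 0) := by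
      refine squeeze_zero (fun k => sq_nonneg _) (fun k => ?_) hlim
      rw [mul_pow]
      gcongr
      exact le_add_of_nonneg_left (potential_nonneg hs hp k)
    refine (by simpa using h1.sqrt : Tendsto _ _ _).congr fun k => ?_
    rw [Real.sqrt_sq (by positivity)]
  have hyz : Tendsto (fun k => ‖y (k + 1) - p‖ - ‖z k - p‖) atTop (𝓝 0) := by
    refine squeeze_zero_norm (fun k => ?_)
      (by simpa using hd.const_mul ((1 + α) + 1 + 1 / (α - 1)))
    have h1 := hT.norm_y_sub_le (by linarith : 0 ≤ α) k
    have h2 : y (k + 1) - z k = (y (k + 1) - x (k + 1)) + (x (k + 1) - x k)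
        - ((k : ℝ) / (α - 1)) • (x (k + 1) - x k) := by
      simp only [z]
      abel
    have hk : (0 : ℝ) ≤ k := by positivity
    have hd0 := norm_nonneg (x (k + 1) - x k)
    have h4 : ‖((k : ℝ) / (α - 1)) • (x (k + 1) - x k)‖
        = 1 / (α - 1) * (k * ‖x (k + 1) - x k‖) := by
      rw [norm_smul, Real.norm_of_nonneg (by positivity)]
      ring
    calc |‖y (k + 1) - p‖ - ‖z k - p‖| ≤ ‖y (k + 1) - p - (z k - p)‖ := abs_norm_sub_norm_le _ _
      _ = ‖(y (k + 1) - x (k + 1)) + (x (k + 1) - x k)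
        - ((k : ℝ) / (α - 1)) • (x (k + 1) - x k)‖ := by rw [sub_sub_sub_cancel_right, h2]
      _ ≤ ‖y (k + 1) - x (k + 1)‖ + ‖x (k + 1) - x k‖
        + ‖((k : ℝ) / (α - 1)) • (x (k + 1) - x k)‖ :=
          (norm_sub_le _ _).trans (by gcongr; exact norm_add_le _ _)
      _ ≤ (1 + α) * ‖x (k + 1) - x k‖ + ‖x (k + 1) - x k‖
        + 1 / (α - 1) * (k * ‖x (k + 1) - x k‖) := by rw [h4]; gcongr
      _ ≤ (1 + α) * ((k + 1) * ‖x (k + 1) - x k‖) + (k + 1) * ‖x (k + 1) - x k‖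
        + 1 / (α - 1) * ((k + 1) * ‖x (k + 1) - x k‖) := by
          have h5 : ‖x (k + 1) - x k‖ ≤ (k + 1) * ‖x (k + 1) - x k‖ := by nlinarith
          gcongr
          linarith
      _ = _ := by ring
  refine ⟨0 + √(2 * (c - 0)), (tendsto_add_atTop_iff_nat 1).1 ?_⟩
  exact (hyz.add hz).congr fun k => by ring

/-- This is weak lower semicontinuity: the tangent at `q` is weakly continuous and lies below `f`.
-/
theorem mem_argmin_of_weak_cluster (hconv : ConvexOn ℝ Set.univ f) (hdiff : Differentiable ℝ f)
    (hp : p ∈ argmin f) {z : ℕ → H} (hz : Tendsto (fun k => f (z k)) atTop (𝓝 (f p))) {q : H}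
    (hq : ∀ v, Tendsto (fun k => inner ℝ v (z k)) atTop (𝓝 (inner ℝ v q))) : q ∈ argmin f := by
  have h1 : Tendsto (fun k => f q + (inner ℝ (gradient f q) (z k) - inner ℝ (gradient f q) q))
      atTop (𝓝 (f q + (inner ℝ (gradient f q) q - inner ℝ (gradient f q) q))) :=
    ((hq _).sub_const _).const_add _
  rw [sub_self, add_zero] at h1
  have h2 : f q ≤ f p := le_of_tendsto_of_tendsto' h1 hz fun k => by
    have := add_inner_gradient_le hconv hdiff q (z k)
    rwa [inner_sub_right] at this
  exact fun v => h2.trans (hp v)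

end Conclusions

theorem tsum_sq_lt_top {a : ℕ → ℝ≥0∞} (ha : ∑' k, a k < ∞) : ∑' k, a k ^ 2 < ∞ := by
  calc ∑' k, a k ^ 2 ≤ ∑' k, a k * ∑' j, a j :=
        ENNReal.tsum_le_tsum fun k => by
          rw [sq]
          gcongr
          exact ENNReal.le_tsum k
    _ = (∑' k, a k) * ∑' j, a j := ENNReal.tsum_mul_right
    _ < ∞ := ENNReal.mul_lt_top ha ha

/-! ### From pathwise energy inequalities to almost sure convergence. -/

section Stochastic

variable {Ω : Type*} {mΩ : MeasurableSpace Ω} {μ : Measure Ω}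
  {H : Type*} [NormedAddCommGroup H] [InnerProductSpace ℝ H] [CompleteSpace H]
  [MeasurableSpace H] [BorelSpace H]

/-- Convergence of an energy that decreases, eventually and up to summable perturbations and
centred noise, along the steps of a stochastic algorithm. -/
theorem ae_tendsto_and_summable_of_energy [IsFiniteMeasure μ] {𝒢 : Filtration ℕ mΩ}
    {e : ℕ → Ω → H} (he : ∀ k, Measurable (e k)) (he_int : ∀ k, 1 ≤ k → Integrable (e k) μ)
    (he_zero : ∀ k, 1 ≤ k → μ[e k | 𝒢 k] =ᵐ[μ] 0) {E D u : ℕ → Ω → ℝ} {M : ℕ → Ω → H}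
    {C : ℕ → ℝ} (N : ℕ) (hE0 : ∀ k ω, 0 ≤ E k ω) (hE : ∀ k, Measurable[𝒢 (k + 1)] (E k))
    (hD0 : ∀ k ω, 0 ≤ D (k + N) ω) (hD : ∀ k, Measurable (D k))
    (hu0 : ∀ k ω, 0 ≤ u k ω) (hu : ∀ k, Measurable[𝒢 (k + 1)] (u k))
    (hM : ∀ k, StronglyMeasurable[𝒢 (k + 1)] (M k)) (hC : ∀ k, 0 ≤ C k)
    (hσ : ∀ k, ∀ᵐ ω ∂μ, condLExp (𝒢 (k + 1)) μ (fun ω' => ‖e (k + 1) ω'‖ₑ ^ 2) ω < ∞)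
    (hCσ : ∀ᵐ ω ∂μ, ∑' k, ENNReal.ofReal (C k)
      * condLExp (𝒢 (k + 1)) μ (fun ω' => ‖e (k + 1) ω'‖ₑ ^ 2) ω < ∞)
    (husum : ∀ᵐ ω ∂μ, Summable fun k => u k ω)
    (hpath : ∀ k ω, E (k + N + 1) ω + D (k + N) ω ≤ E (k + N) ω + u (k + N) ω
      + inner ℝ (M (k + N) ω) (e (k + N + 1) ω) + C (k + N) * ‖e (k + N + 1) ω‖ ^ 2) :
    ∀ᵐ ω ∂μ, (∃ c, Tendsto (fun k => E k ω) atTop (𝓝 c)) ∧ Summable fun k => D k ω := by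
  -- The shift by `N` skips the steps where the inequality may fail. The further shift by one is
  -- needed because the `k`-th energy involves `x (k + 1)`.
  let ℱ : Filtration ℕ mΩ :=
    ⟨fun n => 𝒢 (n + N + 1), fun i j hij => 𝒢.mono (by omega), fun n => 𝒢.le _⟩
  have hRS := robbinsSiegmund (μ := μ) (ℱ := ℱ) (V := fun n => E (n + N))
    (D := fun n ω => ENNReal.ofReal (D (n + N) ω))
    (U := fun n ω => ENNReal.ofReal (u (n + N) ω) + ENNReal.ofReal (C (n + N))
      * condLExp (𝒢 (n + N + 1)) μ (fun ω' => ‖e (n + N + 1) ω'‖ₑ ^ 2) ω)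
    (fun n => hE0 _) (fun n => hE _) (fun n => (hD _).ennreal_ofReal)
    (fun n => (hu (n + N)).ennreal_ofReal.add ((measurable_condLExp _ _ _).const_mul _)) ?_ ?_
  · filter_upwards [hRS] with ω hω
    obtain ⟨⟨c, hc⟩, hsum⟩ := hω
    refine ⟨⟨c, (tendsto_add_atTop_iff_nat N).1 hc⟩, (summable_nat_add_iff N).1 ?_⟩
    refine (ENNReal.summable_toReal hsum.ne).congr fun n => ?_
    exact ENNReal.toReal_ofReal (hD0 n ω)
  · filter_upwards [hCσ, husum] with ω h1 h2
    rw [ENNReal.tsum_add]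
    refine ENNReal.add_lt_top.2 ⟨?_, ?_⟩
    · exact ((summable_nat_add_iff N).2 h2).tsum_ofReal_lt_top
    · exact (ENNReal.tsum_comp_le_tsum_of_injective (add_left_injective N) _).trans_lt h1
  · intro n A hA
    have := setLIntegral_add_le_of_pathwise (𝒢.le (n + N + 1)) (hM (n + N)) (he (n + N + 1))
      (he_int _ (by omega)) (he_zero _ (by omega)) (hE (n + N)) (hE0 _) (hu (n + N)) (hu0 _)
      (hE0 (n + N + 1)) (hD0 n) (hC (n + N)) (hσ (n + N)) (hpath n) hA
    rwa [show n + N + 1 = n + 1 + N by omega] at this ⊢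

end Stochastic

/-! ### The Ravine method as a Nesterov trajectory, and its filtration. -/

section Algorithm

/-- The Nesterov sequence `y 0, w 0, w 1, …`. -/
def nesterovSeq {Ω H : Type*} (y w : ℕ → Ω → H) : ℕ → Ω → H
  | 0 => y 0
  | k + 1 => w k

theorem measurable_nesterovSeq {Ω H : Type*} [MeasurableSpace H] {y w : ℕ → Ω → H} {j k : ℕ} (hjk : j ≤ k) :
    Measurable[canonicalSigma y w k] (nesterovSeq y w j) := by
  refine Measurable.of_comap_le ?_
  cases j with
  | zero => exact le_sup_left
  | succ j =>
    exact le_sup_of_le_right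
      (le_iSup₂_of_le (f := fun i _ => MeasurableSpace.comap (w i) inferInstance) j
        (Finset.mem_range.2 hjk) le_rfl)

variable {Ω H : Type*} [NormedAddCommGroup H] [InnerProductSpace ℝ H] [CompleteSpace H]
  {f : H → ℝ} {s : ℕ → ℝ} {α : ℝ} {e y w : ℕ → Ω → H}

/-- The convention `w (-1) = y 0 = x 0` covers the first extrapolation. The step with `e 0` only
produces `x 1` and is not part of the trajectory, so conditions on the errors are needed from index
`1` only. -/
theorem IsSRAG.isTrajectory (halg : IsSRAG f s (fun k => 1 - α / k) e y w) (ω : Ω) :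
    IsTrajectory f s α (fun k => e k ω) (fun k => y k ω) (fun k => nesterovSeq y w k ω) where
  y_eq k := by
    cases k with
    | zero => simpa [nesterovSeq] using halg.y_one ω
    | succ k =>
      have := halg.y_succ k ω
      simp only [nesterovSeq]
      push_cast at this ⊢
      rw [this, add_assoc (k : ℝ) 1 1, one_add_one_eq_two]
  x_eq k := halg.w_eq (k + 1) ω

variable [mΩ : MeasurableSpace Ω] [TopologicalSpace.SeparableSpace H] [MeasurableSpace H]
  [BorelSpace H]

theorem IsSRAG.measurable {a : ℕ → ℝ} (halg : IsSRAG f s a e y w)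
    (hg : Continuous (gradient f)) (he : ∀ k, Measurable (e k)) (hy0 : Measurable (y 0)) (k : ℕ) :
    Measurable (y k) ∧ Measurable (w k) := by
  have : SecondCountableTopology H := UniformSpace.secondCountable_of_separable H
  have hw : ∀ k, Measurable (y k) → Measurable (w k) := fun k hk => by
    rw [funext (halg.w_eq k)]
    exact hk.sub (((hg.measurable.comp hk).add (he k)).const_smul (s k))
  suffices Measurable (y k) ∧ Measurable (y (k + 1)) from ⟨this.1, hw k this.1⟩
  induction k with
  | zero =>
    refine ⟨hy0, ?_⟩
    rw [funext halg.y_one]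
    exact (hw 0 hy0).add (((hw 0 hy0).sub hy0).const_smul _)
  | succ k ih =>
    refine ⟨ih.2, ?_⟩
    rw [funext (halg.y_succ k)]
    exact (hw _ ih.2).add (((hw _ ih.2).sub (hw _ ih.1)).const_smul _)

/-- The canonical filtration of the algorithm. -/
def canonicalFiltration (hy0 : Measurable (y 0)) (hw : ∀ k, Measurable (w k)) :
    Filtration ℕ mΩ where
  seq := canonicalSigma y w
  mono' _ _ hij := sup_le_sup_left
    (biSup_mono fun _ hk => Finset.mem_range.2 ((Finset.mem_range.1 hk).trans_le hij)) _
  le' _ := sup_le hy0.comap_le (iSup₂_le fun i _ => (hw i).comap_le)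

end Algorithm

theorem tsum_const_mul_lt_top {C b : ℕ → ℝ} {c : ℝ} (hc : 0 ≤ c) (hC : ∀ k, C k = c * b k)
    {v : ℕ → ℝ≥0∞} (h : ∑' k, ENNReal.ofReal (b k) * v k < ∞) :
    ∑' k, ENNReal.ofReal (C k) * v k < ∞ := by
  simp_rw [hC, ENNReal.ofReal_mul hc, mul_assoc, ENNReal.tsum_mul_left]
  exact ENNReal.mul_lt_top ENNReal.ofReal_lt_top h

/-! ### Measurability of energies and noise coefficients. -/

section Measurability

variable {Ω H : Type*} [NormedAddCommGroup H]
  [SecondCountableTopology H] [MeasurableSpace H] [BorelSpace H] {m : MeasurableSpace Ω}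

theorem measurable_anchoredEnergy [InnerProductSpace ℝ H]
    {f : H → ℝ} (hf : Measurable f) (s : ℕ → ℝ) (α : ℝ) (p : H)
    {x : ℕ → Ω → H} {k : ℕ} (h₀ : Measurable (x k)) (h₁ : Measurable (x (k + 1))) :
    Measurable fun ω => anchoredEnergy f s α p (fun j => x j ω) k := by
  unfold anchoredEnergy
  fun_prop

theorem measurable_mechanicalEnergy {f : H → ℝ} (hf : Measurable f) (s : ℕ → ℝ) (p : H)
    {x : ℕ → Ω → H} {k : ℕ} (h₀ : Measurable (x k)) (h₁ : Measurable (x (k + 1))) :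
    Measurable fun ω => mechanicalEnergy f s p (fun j => x j ω) k := by
  unfold mechanicalEnergy
  fun_prop

theorem measurable_anchored_noise_coefficient [InnerProductSpace ℝ H]
    {g : H → H} (hg : Measurable g) (p : H)
    (a b c d : ℝ) {x₀ x₁ y : Ω → H} (h₀ : Measurable x₀) (h₁ : Measurable x₁) (hy : Measurable y) :
    Measurable fun ω => a • (g (y ω) - g (y ω - b • g (y ω)))
      - c • (x₀ ω + d • (x₁ ω - x₀ ω) - p) := by
  fun_prop

theorem measurable_mechanical_noise_coefficient [InnerProductSpace ℝ H]
    {g : H → H} (hg : Measurable g)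
    (a b c : ℝ) {x y : Ω → H} (hx : Measurable x) (hy : Measurable y) :
    Measurable fun ω => a • (b • g (y ω) - c • (y ω - x ω)) := by
  fun_prop

theorem measurable_anchored_dissipation {f : H → ℝ} {g : H → H} (hf : Measurable f)
    (hg : Measurable g) (p : H) (a b c d r : ℝ) {x₁ x₂ y : Ω → H} (h₁ : Measurable x₁)
    (h₂ : Measurable x₂) (hy : Measurable y) :
    Measurable fun ω => a * (b * (f (x₁ ω) - f p)) + c * (d * ‖g (y ω) - g (x₁ ω)‖ ^ 2)
      + c * (r * ‖g (x₂ ω)‖ ^ 2) := by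
  fun_prop

theorem measurable_of_isTrajectory [InnerProductSpace ℝ H] [CompleteSpace H] {f : H → ℝ}
    {s : ℕ → ℝ} {α : ℝ} {e y x : ℕ → Ω → H} (hT : ∀ ω, IsTrajectory f s α (e · ω) (y · ω) (x · ω))
    {k : ℕ} (h₀ : Measurable (x k)) (h₁ : Measurable (x (k + 1))) :
    Measurable (y (k + 1)) := by
  rw [funext fun ω => (hT ω).y_eq k]
  exact h₁.add ((h₁.sub h₀).const_smul _)

end Measurability

/-! ### Almost sure convergence of the two energies. -/

section Convergence

variable {Ω : Type*} [mΩ : MeasurableSpace Ω] {μ : Measure Ω} [IsFiniteMeasure μ]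
  {H : Type*} [NormedAddCommGroup H] [InnerProductSpace ℝ H] [CompleteSpace H]
  [SecondCountableTopology H] [MeasurableSpace H] [BorelSpace H]
  {f : H → ℝ} {L : ℝ≥0} {s : ℕ → ℝ} {α : ℝ} {e y x : ℕ → Ω → H} {p : H} {𝒢 : Filtration ℕ mΩ}

/-- Robbins-Siegmund is started at `⌈2 * α⌉₊`, with the quadratic noise as the only perturbation.
The three dissipation terms are nonnegative, so each is summable separately. -/
theorem ae_anchoredEnergy (hconv : ConvexOn ℝ Set.univ f) (hdiff : Differentiable ℝ f)
    (hL : 0 < L) (hLip : LipschitzWith L (gradient f)) (hs : ∀ k, s k ∈ Set.Ioc 0 (1 / (L : ℝ)))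
    (hs_anti : Antitone s) (hα : 3 < α) (hp : p ∈ argmin f) (he : ∀ k, Measurable (e k))
    (he_int : ∀ k, 1 ≤ k → Integrable (e k) μ) (he_zero : ∀ k, 1 ≤ k → μ[e k | 𝒢 k] =ᵐ[μ] 0)
    (hT : ∀ ω, IsTrajectory f s α (e · ω) (y · ω) (x · ω))
    (hx : ∀ {j k : ℕ}, j ≤ k → Measurable[𝒢 k] (x j))
    (hσ : ∀ k, ∀ᵐ ω ∂μ, condLExp (𝒢 (k + 1)) μ (fun ω' => ‖e (k + 1) ω'‖ₑ ^ 2) ω < ∞)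
    (hsum : ∀ᵐ ω ∂μ, ∑' k : ℕ, ENNReal.ofReal (((k + 1) * s (k + 1)) ^ 2)
      * condLExp (𝒢 (k + 1)) μ (fun ω' => ‖e (k + 1) ω'‖ₑ ^ 2) ω < ∞) :
    ∀ᵐ ω ∂μ, (∃ c, Tendsto (anchoredEnergy f s α p (x · ω)) atTop (𝓝 c)) ∧
      (Summable fun k : ℕ => (k + 1) * s (k + 1) * (f (x (k + 1) ω) - f p)) ∧
      (Summable fun k : ℕ => ((k + 1) * s (k + 1)) ^ 2
        * ‖gradient f (y (k + 1) ω) - gradient f (x (k + 1) ω)‖ ^ 2) ∧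
      Summable fun k : ℕ => ((k + 1) * s (k + 1)) ^ 2 * ‖gradient f (x (k + 2) ω)‖ ^ 2 := by
  have hα1 : 0 < α - 1 := by linarith
  have hα3 : 0 < α - 3 := by linarith
  have hfm : Measurable f := hdiff.continuous.measurable
  have hgm : Measurable (gradient f) := hLip.continuous.measurable
  have hx' : ∀ k, Measurable (x k) := fun k => (hx le_rfl).mono (𝒢.le k) le_rfl
  have hpot : ∀ k ω, 0 ≤ (k + 1) * s (k + 1) * (f (x (k + 1) ω) - f p) := fun k ω => by
    have := (hs (k + 1)).1
    have := sub_nonneg.2 (hp (x (k + 1) ω))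
    positivity
  have key := ae_tendsto_and_summable_of_energy he he_int he_zero
    (E := fun k ω => anchoredEnergy f s α p (x · ω) k)
    (D := fun k ω => (α - 3) / (α - 1) ^ 2 * ((k + 1) * s (k + 1) * (f (x (k + 1) ω) - f p))
        + 1 / (4 * (α - 1) ^ 2) * (((k + 1) * s (k + 1)) ^ 2
            * ‖gradient f (y (k + 1) ω) - gradient f (x (k + 1) ω)‖ ^ 2)
        + 1 / (4 * (α - 1) ^ 2) * (((k + 1) * s (k + 1)) ^ 2 * ‖gradient f (x (k + 2) ω)‖ ^ 2))
    (u := fun _ _ => 0)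
    (M := fun k ω => (s (k + 1) ^ 2 * ((k + 1) / (α - 1)) ^ 2) • (gradient f (y (k + 1) ω)
            - gradient f (y (k + 1) ω - s (k + 1) • gradient f (y (k + 1) ω)))
          - (s (k + 1) * ((k + 1) / (α - 1))) • (x k ω + (k / (α - 1)) • (x (k + 1) ω - x k ω) - p))
    (C := fun k => 3 / 2 * (1 / (α - 1) ^ 2) * ((k + 1) * s (k + 1)) ^ 2) ⌈2 * α⌉₊
    (fun k ω => ?_) (fun k => ?_) (fun k ω => ?_) (fun k => ?_) (fun _ _ => le_rfl)
    (fun _ => measurable_const) (fun k => ?_) (fun k => by positivity) hσ ?_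
    (Eventually.of_forall fun _ => summable_zero) (fun k ω => ?_)
  · filter_upwards [key] with ω ⟨hlim, hsummable⟩
    have hA := fun k => hpot k ω
    have hle : ∀ {a : ℝ} {b : ℕ → ℝ}, 0 < a → (∀ k, 0 ≤ b k) → (∀ k : ℕ, a * b k ≤
        (α - 3) / (α - 1) ^ 2 * ((k + 1) * s (k + 1) * (f (x (k + 1) ω) - f p))
        + 1 / (4 * (α - 1) ^ 2) * (((k + 1) * s (k + 1)) ^ 2
            * ‖gradient f (y (k + 1) ω) - gradient f (x (k + 1) ω)‖ ^ 2)
        + 1 / (4 * (α - 1) ^ 2) * (((k + 1) * s (k + 1)) ^ 2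
            * ‖gradient f (x (k + 2) ω)‖ ^ 2)) → Summable b := fun ha hb h =>
      (summable_mul_left_iff ha.ne').1
        (Summable.of_nonneg_of_le (fun k => mul_nonneg ha.le (hb k)) h hsummable)
    refine ⟨hlim, hle (a := (α - 3) / (α - 1) ^ 2) (by positivity) hA fun k => ?_,
      hle (a := 1 / (4 * (α - 1) ^ 2)) (by positivity) (fun k => by positivity) fun k => ?_,
      hle (a := 1 / (4 * (α - 1) ^ 2)) (by positivity) (fun k => by positivity) fun k => ?_⟩
    · rw [add_assoc]
      exact le_add_of_nonneg_right (by positivity)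
    · rw [add_right_comm]
      exact le_add_of_nonneg_left (add_nonneg (mul_nonneg (by positivity) (hA k)) (by positivity))
    · exact le_add_of_nonneg_left (add_nonneg (mul_nonneg (by positivity) (hA k)) (by positivity))
  · have := (hs (k + 1)).1
    have := sub_nonneg.2 (hp (x (k + 1) ω))
    unfold anchoredEnergy
    positivity
  · exact measurable_anchoredEnergy hfm s α p (hx (Nat.le_succ k)) (hx le_rfl)
  · have := hpot (k + ⌈2 * α⌉₊) ω
    exact add_nonneg (add_nonneg (mul_nonneg (by positivity) this) (by positivity)) (by positivity)
  · exact measurable_anchored_dissipation hfm hgm p _ _ _ _ _ (hx' _) (hx' _)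
      (measurable_of_isTrajectory hT (hx' _) (hx' _))
  · exact (measurable_anchored_noise_coefficient hgm p _ _ _ _ (hx (Nat.le_succ k)) (hx le_rfl)
      (measurable_of_isTrajectory hT (hx (Nat.le_succ k)) (hx le_rfl))).stronglyMeasurable
  · filter_upwards [hsum] with ω hω
    exact tsum_const_mul_lt_top (by positivity) (fun k => rfl) hω
  · have hk : 2 * α ≤ (k + ⌈2 * α⌉₊ : ℕ) := by
      push_cast
      linarith [Nat.le_ceil (2 * α), Nat.cast_nonneg (α := ℝ) k]
    rw [add_zero]
    exact (hT ω).anchoredEnergy_succ_le hconv hdiff hL hLip hs hs_anti hα hp hk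

/-- The growth of the weight `k²` is a perturbation bounded by twice the series in `hpot`. The start
`⌈α⌉₊` makes the kinetic dissipation nonnegative. -/
theorem ae_mechanicalEnergy (hconv : ConvexOn ℝ Set.univ f) (hdiff : Differentiable ℝ f)
    (hL : 0 < L) (hLip : LipschitzWith L (gradient f)) (hs : ∀ k, s k ∈ Set.Ioc 0 (1 / (L : ℝ)))
    (hs_anti : Antitone s) (hα : 1 < α) (hp : p ∈ argmin f) (he : ∀ k, Measurable (e k))
    (he_int : ∀ k, 1 ≤ k → Integrable (e k) μ) (he_zero : ∀ k, 1 ≤ k → μ[e k | 𝒢 k] =ᵐ[μ] 0)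
    (hT : ∀ ω, IsTrajectory f s α (e · ω) (y · ω) (x · ω))
    (hx : ∀ {j k : ℕ}, j ≤ k → Measurable[𝒢 k] (x j))
    (hσ : ∀ k, ∀ᵐ ω ∂μ, condLExp (𝒢 (k + 1)) μ (fun ω' => ‖e (k + 1) ω'‖ₑ ^ 2) ω < ∞)
    (hsum : ∀ᵐ ω ∂μ, ∑' k : ℕ, ENNReal.ofReal (((k + 1) * s (k + 1)) ^ 2)
      * condLExp (𝒢 (k + 1)) μ (fun ω' => ‖e (k + 1) ω'‖ₑ ^ 2) ω < ∞)
    (hpot : ∀ᵐ ω ∂μ, Summable fun k : ℕ => (k + 1) * s (k + 1) * (f (x (k + 1) ω) - f p)) :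
    ∀ᵐ ω ∂μ, (∃ c, Tendsto (mechanicalEnergy f s p (x · ω)) atTop (𝓝 c)) ∧
      Summable fun k : ℕ => 1 / 2 * ((α - 1) * (2 * k + 1 - α)) * ‖x (k + 1) ω - x k ω‖ ^ 2 := by
  have hα1 : 0 < α - 1 := by linarith
  have hfm : Measurable f := hdiff.continuous.measurable
  have hgm : Measurable (gradient f) := hLip.continuous.measurable
  have hx' : ∀ k, Measurable (x k) := fun k => (hx le_rfl).mono (𝒢.le k) le_rfl
  have hgap : ∀ (k : ℕ) ω, 0 ≤ s (k + 1) * (f (x (k + 1) ω) - f p) := fun k ω =>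
    potential_nonneg (x := (x · ω)) (fun k => (hs k).1) hp k
  refine ae_tendsto_and_summable_of_energy he he_int he_zero
    (E := fun k ω => mechanicalEnergy f s p (x · ω) k)
    (D := fun k ω => 1 / 2 * ((α - 1) * (2 * k + 1 - α)) * ‖x (k + 1) ω - x k ω‖ ^ 2)
    (u := fun k ω => (2 * k + 1) * s (k + 1) * (f (x (k + 1) ω) - f p))
    (M := fun k ω => ((k : ℝ) + 1) ^ 2 • (s (k + 1) ^ 2 • gradient f (y (k + 1) ω)
        - s (k + 1) • (y (k + 1) ω - x (k + 1) ω)))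
    (C := fun k => 1 * ((k + 1) * s (k + 1)) ^ 2) ⌈α⌉₊
    (fun k ω => ?_) (fun k => ?_) (fun k ω => ?_) (fun k => ?_) (fun k ω => ?_)
    (fun k => ?_) (fun k => ?_) (fun k => by positivity) hσ ?_ ?_ (fun k ω => ?_)
  · have := hgap k ω
    unfold mechanicalEnergy
    positivity
  · exact measurable_mechanicalEnergy hfm s p (hx (Nat.le_succ k)) (hx le_rfl)
  · have hk : α ≤ (k + ⌈α⌉₊ : ℕ) := by
      push_cast
      linarith [Nat.le_ceil α, Nat.cast_nonneg (α := ℝ) k]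
    refine mul_nonneg (mul_nonneg (by norm_num) (mul_nonneg hα1.le ?_)) (sq_nonneg _)
    linarith
  · exact (((hx' _).sub (hx' _)).norm.pow_const 2).const_mul _
  · rw [mul_assoc]
    exact mul_nonneg (by positivity) (hgap k ω)
  · exact ((hfm.comp (hx le_rfl)).sub_const _).const_mul _
  · exact (measurable_mechanical_noise_coefficient hgm _ _ _ (hx le_rfl)
      (measurable_of_isTrajectory hT (hx (Nat.le_succ k)) (hx le_rfl))).stronglyMeasurable
  · filter_upwards [hsum] with ω hω
    exact tsum_const_mul_lt_top zero_le_one (fun k => rfl) hω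
  · filter_upwards [hpot] with ω hω
    refine Summable.of_nonneg_of_le (fun k => ?_) (fun k => ?_) (hω.mul_left 2)
    · rw [mul_assoc]
      exact mul_nonneg (by positivity) (hgap k ω)
    · have := hgap k ω
      rw [mul_assoc, mul_assoc, ← mul_assoc 2]
      gcongr
      linarith
  · exact (hT ω).mechanicalEnergy_succ_le hconv hdiff hL hLip hs hs_anti hp _

end Convergence

end StochRavine

/-! ### Assembly of the theorem. -/

theorem corollary5p1
    {Ω : Type*} [MeasurableSpace Ω] (μ : Measure Ω) [IsProbabilityMeasure μ]
    {H : Type*} [NormedAddCommGroup H] [InnerProductSpace ℝ H] [CompleteSpace H]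
    [TopologicalSpace.SeparableSpace H] [MeasurableSpace H] [BorelSpace H]
    -- the objective function
    (f : H → ℝ) (hconv : ConvexOn ℝ Set.univ f) (hdiff : Differentiable ℝ f)
    (L : ℝ≥0) (hL : 0 < L) (hLip : LipschitzWith L (gradient f))
    (hS : (StochRavine.argmin f).Nonempty)
    -- the step sizes and the extrapolation parameter
    (s : ℕ → ℝ) (hs : ∀ k, s k ∈ Set.Ioc 0 (1 / (L : ℝ))) (hs_anti : Antitone s)
    (α : ℝ) (hα : 3 < α)
    -- the algorithm, with a square-integrable starting point
    (e y w : ℕ → Ω → H) (he : ∀ k, Measurable (e k))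
    (hy0_meas : Measurable (y 0)) (hy0 : MemLp (y 0) 2 μ)
    (halg : StochRavine.IsSRAG f s (fun k => 1 - α / k) e y w)
    -- the errors are conditionally centred, and `k s_k σ_k` is almost surely summable
    (he_int : ∀ k, 1 ≤ k → Integrable (e k) μ)
    (he_zero : ∀ k, 1 ≤ k → μ[e k | StochRavine.canonicalSigma y w k] =ᵐ[μ] 0)
    (he_sum : ∀ᵐ ω ∂μ, ∑' k : ℕ, ENNReal.ofReal (k * s k) *
      StochRavine.condStd μ (StochRavine.canonicalSigma y w k) (e k) ω < ∞) :
    -- (i)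
    (∀ᵐ ω ∂μ,
      ((fun k : ℕ => f (y k ω) - ⨅ x, f x) =o[atTop] fun k : ℕ => 1 / (s k * (k : ℝ) ^ 2)) ∧
      ((fun k : ℕ => ‖y k ω - y (k - 1) ω‖) =o[atTop] fun k : ℕ => 1 / (k : ℝ))) ∧
    -- (ii)
    (∀ᵐ ω ∂μ,
      Summable (fun k : ℕ => k * s k * (f (y k ω) - ⨅ x, f x)) ∧
      Summable (fun k : ℕ => k * ‖y k ω - y (k - 1) ω‖ ^ 2)) ∧
    -- (iii)
    (0 < ⨅ k, s k →
      (∀ᵐ ω ∂μ, Summable (fun k : ℕ => (k : ℝ) ^ 2 * ‖gradient f (y k ω)‖ ^ 2)) ∧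
      ∃ Y : Ω → H, Measurable Y ∧ (∀ ω, Y ω ∈ StochRavine.argmin f) ∧
        ∀ᵐ ω ∂μ, StochRavine.WeaklyConverges (fun k => y k ω) (Y ω)) := by
  open StochRavine in
  have : SecondCountableTopology H := UniformSpace.secondCountable_of_separable H
  have hs0 : ∀ k, 0 < s k := fun k => (hs k).1
  have hmeas := halg.measurable hLip.continuous he hy0_meas
  let 𝒢 := canonicalFiltration hy0_meas fun k => (hmeas k).2
  have hT := halg.isTrajectory
  have hx : ∀ {j k : ℕ}, j ≤ k → Measurable[𝒢 k] (nesterovSeq y w j) := fun h =>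
    measurable_nesterovSeq h
  have hsq : ∀ k ω, (ENNReal.ofReal (k * s k) * condStd μ (canonicalSigma y w k) (e k) ω) ^ 2
      = ENNReal.ofReal ((k * s k) ^ 2)
        * condLExp (canonicalSigma y w k) μ (fun ω' => ‖e k ω'‖ₑ ^ 2) ω := fun k ω => by
    have := hs0 k
    rw [mul_pow, ← ENNReal.ofReal_pow (by positivity), condStd, ← ENNReal.rpow_natCast,
      ← ENNReal.rpow_mul]
    norm_num
  have hsum : ∀ᵐ ω ∂μ, ∑' k : ℕ, ENNReal.ofReal (((k + 1) * s (k + 1)) ^ 2)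
      * condLExp (𝒢 (k + 1)) μ (fun ω' => ‖e (k + 1) ω'‖ₑ ^ 2) ω < ∞ := by
    filter_upwards [he_sum] with ω hω
    refine lt_of_le_of_lt ?_ (tsum_sq_lt_top hω)
    refine le_of_eq_of_le (tsum_congr fun k => ?_)
      (ENNReal.tsum_comp_le_tsum_of_injective (add_left_injective 1) _)
    rw [hsq]
    push_cast
    rfl
  -- Finite conditional variance is not assumed; it follows from the summability because every
  -- weight `(k + 1) s (k + 1)` is positive.
  have hσ : ∀ k, ∀ᵐ ω ∂μ,
      condLExp (𝒢 (k + 1)) μ (fun ω' => ‖e (k + 1) ω'‖ₑ ^ 2) ω < ∞ := fun k => by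
    filter_upwards [hsum] with ω hω
    have h1 := (ENNReal.le_tsum k).trans_lt hω
    refine ENNReal.lt_top_of_mul_ne_top_right h1.ne ?_
    have := hs0 (k + 1)
    exact (ENNReal.ofReal_pos.2 (by positivity)).ne'
  have hanch := fun p (hp : p ∈ argmin f) => ae_anchoredEnergy hconv hdiff hL hLip hs hs_anti hα hp
    he he_int he_zero hT hx hσ hsum
  obtain ⟨p, hp⟩ := hS
  have hmech := ae_mechanicalEnergy hconv hdiff hL hLip hs hs_anti (by linarith) hp
    he he_int he_zero hT hx hσ hsum ((hanch p hp).mono fun ω h => h.2.1)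
  have hres : ∀ᵐ ω ∂μ,
      Summable (fun k : ℕ => (k + 1) * localResidual f s p (nesterovSeq y w · ω) k) ∧
      Tendsto (fun k : ℕ => ((k : ℝ) + 1) ^ 2 * localResidual f s p (nesterovSeq y w · ω) k)
        atTop (𝓝 0) := by
    filter_upwards [hanch p hp, hmech] with ω h1 h2
    exact localResidual_summable_and_tendsto (x := (nesterovSeq y w · ω)) hs0 hp (by linarith)
      h1.2.1 h2.2 h2.1
  have hα0 : 0 ≤ α := by linarith
  refine ⟨?_, ?_, fun hinf => ⟨?_, ?_⟩⟩
  · filter_upwards [hres] with ω h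
    exact ⟨(hT ω).values_isLittleO hconv hdiff hL hLip hs hα0 hp h.2,
      (hT ω).increments_isLittleO hs0 hα0 hp h.2⟩
  · filter_upwards [hres] with ω h
    exact ⟨(hT ω).summable_values hconv hdiff hL hLip hs hα0 hp h.1,
      (hT ω).summable_increments hs0 hα0 hp h.1⟩
  all_goals
    have hσs : ∀ k, (⨅ k, s k) ≤ s k := fun k =>
      ciInf_le ⟨0, by rintro _ ⟨j, rfl⟩; exact (hs0 j).le⟩ k
  · filter_upwards [hanch p hp] with ω h
    exact summable_sq_mul_norm_gradient_sq (x := (nesterovSeq y w · ω)) (y := (y · ω)) hinf hσs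
      h.2.2.1 h.2.2.2
  · refine exists_measurable_weak_limit (fun k => (hmeas k).1) ⟨p, hp⟩ ?_
    -- The null set in `hanch` depends on the anchor, so only countably many anchors can be handled
    -- at once.
    obtain ⟨T, hTsub, hTc, hTd⟩ := TopologicalSpace.IsSeparable.exists_countable_dense_subset
      (TopologicalSpace.IsSeparable.of_separableSpace (argmin f))
    have hall : ∀ᵐ ω ∂μ, ∀ q ∈ T, ∃ c,
        Tendsto (anchoredEnergy f s α q (nesterovSeq y w · ω)) atTop (𝓝 c) :=
      (ae_ball_iff hTc).2 fun q hq => (hanch q (hTsub hq)).mono fun ω h => h.1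
    filter_upwards [hall, hres] with ω h1 h2
    have hval := (hT ω).tendsto_values hconv hdiff hL hLip hs hα0 hp h2.2
    have hfy := tendsto_comp_of_tendsto_values hinf hσs hp hval
    refine exists_weak_limit ⟨p, hp⟩ hTd (fun q hq => ?_) fun q φ hφ hq =>
      mem_argmin_of_weak_cluster hconv hdiff hp (hfy.comp hφ.tendsto_atTop) hq
    have hqm := hTsub hq
    -- The residual depends on the anchor only through the minimal value, so its limit for `p`
    -- serves every `q`.
    have hpq : f q = f p := le_antisymm (hqm p) (hp q)
    refine (hT ω).exists_tendsto_norm_sub hs0 (by linarith) hqm ?_ (h1 q hq)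
    simpa only [localResidual, hpq] using h2.2
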